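/- Let $c\ge 0$, $\alpha\in[0,1]$ and $\beta=\sqrt{1-\alpha^2}$. There is exactly one global solution $(\boldsymbol m,\boldsymbol n,\boldsymbol b):\mathbb R\to(\mathbb R^3)^3$ of the Serret--Frenet system $$\boldsymbol m'=k\,\boldsymbol n,\qquad \boldsymbol n'=-k\,\boldsymbol m+\tau\,\boldsymbol b,\qquad \boldsymbol b'=-\tau\,\boldsymbol n,\qquad k(x)=c\,e^{-\alpha x^2/4},\quad \tau(x)=\frac{\beta x}{2},$$ with $\boldsymbol m(0)=e_1$, $\boldsymbol n(0)=e_2$, $\boldsymbol b(0)=e_3$. Its first vector $\boldsymbol m_{c,\alpha}=\boldsymbol m$ (the expander profile of the one-dimensional Landau--Lifshitz--Gilbert equation) has the following properties. (1) The first component of $\boldsymbol m_{c,\alpha}$ is even; the second and third components are odd. (2) There exist a unit vector $A^+=(A_1^+,A_2^+,A_3^+)\in\mathbb R^3$ and $a_1,a_2,a_3\in[0,2\pi)$, depending on $c$ and $\alpha$, such that for all $s\ge s_0:=4\sqrt{8+c^2}$ and $j\in\{1,2,3\}$, with $B_j^+=\sqrt{1-(A_j^+)^2}$ and $$\phi_j(s)=a_j+\beta\int_{s_0^2/4}^{s^2/4}\sqrt{1+c^2\frac{e^{-2\alpha\sigma}}{\sigma}}\,d\sigma,$$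 one has $$m_{j,c,\alpha}(s)=A_j^+-\frac{2c}{s}B_j^+e^{-\alpha s^2/4}\bigl(\alpha\sin\phi_j(s)+\beta\cos\phi_j(s)\bigr)-\frac{2c^2}{s^2}A_j^+e^{-\alpha s^2/2}+R_j(s),\qquad |R_j(s)|\le K\,\frac{e^{-\alpha s^2/4}}{s^3},$$ where the constant $K>0$ depends only on $c$ (not on $\alpha$, $s$ or $j$). (3) With the same $A^+$, let $A^-=(A_1^+,-A_2^+,-A_3^+)$ and $\boldsymbol m^0=A^+\chi_{(0,\infty)}+A^-\chi_{(-\infty,0)}$. As $t\to0^+$, $\boldsymbol m_{c,\alpha}(x/\sqrt t)\to A^+$ for every $x>0$ and $\boldsymbol m_{c,\alpha}(x/\sqrt t)\to A^-$ for every $x<0$. Moreover, for every $p\in(1,\infty)$ there is a constant $C=C(c,\alpha,p)$ such that $$\bigl\|\boldsymbol m_{c,\alpha}(\cdot/\sqrt t)-\boldsymbol m^0\bigr\|_{L^p(\mathbb R)}\le C\,t^{1/(2p)}\qquad\text{for all }t>0.$$ -/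

import Mathlib

open Filter Topology MeasureTheory

namespace Expander

/-- Euclidean three-space. -/
abbrev E3 : Type := EuclideanSpace ℝ (Fin 3)

/-- The gyroscopic coefficient `β = √(1 - α²)` attached to the damping `α ∈ [0,1]`. -/
noncomputable def beta (α : ℝ) : ℝ := Real.sqrt (1 - α ^ 2)

/-- The curvature `k(x) = c e^{-α x²/4}`. -/
noncomputable def curvature (c α x : ℝ) : ℝ := c * Real.exp (-α * x ^ 2 / 4)

/-- The torsion `τ(x) = β x / 2`. -/
noncomputable def torsion (α x : ℝ) : ℝ := beta α * x / 2

/-- `(m, n, b)` is a global solution on `ℝ` of the Serret-Frenet system with curvature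
`c e^{-α x²/4}` and torsion `β x / 2`, starting at `x = 0` from the canonical basis. -/
structure IsFrenetFrame (c α : ℝ) (m n b : ℝ → E3) : Prop where
  deriv_m : ∀ x, HasDerivAt m (curvature c α x • n x) x
  deriv_n : ∀ x, HasDerivAt n (-(curvature c α x • m x) + torsion α x • b x) x
  deriv_b : ∀ x, HasDerivAt b (-(torsion α x • n x)) x
  m_zero : m 0 = EuclideanSpace.single 0 1
  n_zero : n 0 = EuclideanSpace.single 1 1
  b_zero : b 0 = EuclideanSpace.single 2 1

/-- The threshold `s₀ = 4 √(8 + c²)`. -/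
noncomputable def s0 (c : ℝ) : ℝ := 4 * Real.sqrt (8 + c ^ 2)

/-- The phase `φ(s) = a + β ∫_{s₀²/4}^{s²/4} √(1 + c² e^{-2ασ}/σ) dσ` with offset `a`. -/
noncomputable def phase (c α a s : ℝ) : ℝ :=
  a + beta α * ∫ σ in (s0 c ^ 2 / 4)..(s ^ 2 / 4),
    Real.sqrt (1 + c ^ 2 * (Real.exp (-2 * α * σ) / σ))

/-- The `j`-th component `(1 - A_j²)^{1/2}` of the amplitude vector `B⁺` determined by `A⁺`. -/
noncomputable def amplitude (A : E3) (j : Fin 3) : ℝ := Real.sqrt (1 - A j ^ 2)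

/-- The `j`-th component of the explicit part of the expansion at `s`, for the limit vector `A`
and the phase offsets `a`. -/
noncomputable def expansion (c α : ℝ) (A : E3) (a : Fin 3 → ℝ) (s : ℝ) (j : Fin 3) : ℝ :=
  A j
    - 2 * c / s * amplitude A j * Real.exp (-α * s ^ 2 / 4) *
        (α * Real.sin (phase c α (a j) s) + beta α * Real.cos (phase c α (a j) s))
    - 2 * c ^ 2 / s ^ 2 * A j * Real.exp (-α * s ^ 2 / 2)

/-- The vector `A⁻ = (A₁, -A₂, -A₃)`. -/
noncomputable def reflect (A : E3) : E3 := !₂[A 0, -A 1, -A 2]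

/-- The jump datum `A⁺ χ_{(0,∞)} + A⁻ χ_{(-∞,0)}`. -/
noncomputable def jumpDatum (A : E3) (x : ℝ) : E3 :=
  (Set.Ioi (0 : ℝ)).indicator (fun _ => A) x + (Set.Iio (0 : ℝ)).indicator (fun _ => reflect A) x

end Expander

/-! The vector system decouples: for each `j`, the triple of `j`-th coordinates of the frame solves
one scalar Serret-Frenet system, whose matrix is antisymmetric. Inner products of solutions are
therefore conserved, which gives uniqueness, global existence (no blow-up) and orthonormality;
parity follows from uniqueness applied to a reflected frame.

For the asymptotics write `x` for the tangent coordinate and `E = exp(ζ s²/4)` with `ζ = -α + iβ`,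
`|ζ| = 1`, and set `M = (y + iz) exp(iβ s²/4)`. The torsion disappears: `x' = c Re(Ē M)`, `M' = -c x
E`. Since `E' = (ζ s/2) E`, each integration by parts gains powers of `1/s`. Applied to `x'` it
expresses `x - A` through `M` up to order `s⁻³` (`exists_limit`, `norm_stage_two_le`). Applied to
`M'` it leaves one non-oscillating term, `c² ζ̄ |E|² M / s`. The real part of its coefficient is
integrable uniformly in `α`, while the imaginary part is a phase drift (logarithmic if `α = 0`),
matched by the square root in the phase since `(s/2)(√(1 + 4c²|E|²/s²) - 1) ≈ c²|E|²/s`. After this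
compensation the corrected normal component converges to some `W` at rate `s⁻²`
(`exists_amplitude`). Substituting back yields the expansion, and `x² + |M|² = 1` gives `|W|² = 1 -
A²`.

All constants are independent of `α` because errors are compared with the derivative of `e^{-αs²/4}
s^{-n}`, which absorbs both slowly decaying terms carrying a factor `α` and fast decaying terms
without one.

Finally, `m` minus the jump datum is `O(1/(1+|x|))`, hence in `L^p` for `p > 1`, and the jump datum
is invariant under dilations, so the rate in `t` is pure scaling. -/

namespace Expander

/-! ### The scalar Serret-Frenet system: conservation, uniqueness, global existence. -/

/-- `(x, y, z)` solves on `U` the scalar Serret-Frenet system with curvature `k` and torsion `τ`. -/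
structure IsFrenetOn (k τ : ℝ → ℝ) (U : Set ℝ) (x y z : ℝ → ℝ) : Prop where
  dx : ∀ t ∈ U, HasDerivAt x (k t * y t) t
  dy : ∀ t ∈ U, HasDerivAt y (-(k t * x t) + τ t * z t) t
  dz : ∀ t ∈ U, HasDerivAt z (-(τ t * y t)) t

lemma eq_of_hasDerivAt_zero {f : ℝ → ℝ} {U : Set ℝ} (hU : IsOpen U) (hc : IsPreconnected U)
    (h : ∀ t ∈ U, HasDerivAt f 0 t) {s t : ℝ} (hs : s ∈ U) (ht : t ∈ U) : f s = f t := by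
  refine hU.is_const_of_deriv_eq_zero hc
    (fun x hx => (h x hx).differentiableAt.differentiableWithinAt) ?_ hs ht
  intro x hx
  exact (h x hx).deriv

namespace IsFrenetOn

variable {k τ : ℝ → ℝ} {U V : Set ℝ} {x y z x' y' z' : ℝ → ℝ}

lemma mono (h : IsFrenetOn k τ U x y z) (hV : V ⊆ U) : IsFrenetOn k τ V x y z :=
  ⟨fun t ht => h.dx t (hV ht), fun t ht => h.dy t (hV ht), fun t ht => h.dz t (hV ht)⟩

/-- The inner product of two scalar solutions is conserved. -/
lemma inner_const (h : IsFrenetOn k τ U x y z) (h' : IsFrenetOn k τ U x' y' z')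
    (hU : IsOpen U) (hc : IsPreconnected U) {s t : ℝ} (hs : s ∈ U) (ht : t ∈ U) :
    x s * x' s + y s * y' s + z s * z' s = x t * x' t + y t * y' t + z t * z' t := by
  refine eq_of_hasDerivAt_zero (f := fun s => x s * x' s + y s * y' s + z s * z' s) hU hc
    (fun r hr => ?_) hs ht
  refine ((((h.dx r hr).mul (h'.dx r hr)).add ((h.dy r hr).mul (h'.dy r hr))).add
    ((h.dz r hr).mul (h'.dz r hr))).congr_deriv ?_
  ring

lemma sub (h : IsFrenetOn k τ U x y z) (h' : IsFrenetOn k τ U x' y' z') :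
    IsFrenetOn k τ U (fun t => x t - x' t) (fun t => y t - y' t) (fun t => z t - z' t) := by
  refine ⟨fun t ht => ?_, fun t ht => ?_, fun t ht => ?_⟩
  · exact ((h.dx t ht).sub (h'.dx t ht)).congr_deriv (by ring)
  · exact ((h.dy t ht).sub (h'.dy t ht)).congr_deriv (by ring)
  · exact ((h.dz t ht).sub (h'.dz t ht)).congr_deriv (by ring)

lemma unique (h : IsFrenetOn k τ U x y z) (h' : IsFrenetOn k τ U x' y' z')
    (hU : IsOpen U) (hc : IsPreconnected U) {t₀ t : ℝ} (h₀ : t₀ ∈ U) (ht : t ∈ U)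
    (hx : x t₀ = x' t₀) (hy : y t₀ = y' t₀) (hz : z t₀ = z' t₀) :
    x t = x' t ∧ y t = y' t ∧ z t = z' t := by
  have e := (h.sub h').inner_const (h.sub h') hU hc ht h₀
  simp only [hx, hy, hz, sub_self, mul_zero, add_zero] at e
  have h1 := mul_self_nonneg (x t - x' t)
  have h2 := mul_self_nonneg (y t - y' t)
  have h3 := mul_self_nonneg (z t - z' t)
  refine ⟨?_, ?_, ?_⟩ <;> refine sub_eq_zero.1 (mul_self_eq_zero.1 ?_) <;> linarith

end IsFrenetOn

/-- A solution of the Serret-Frenet system on a bounded symmetric interval. -/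
lemma exists_isFrenetOn_Ioo {k τ : ℝ → ℝ} (hk : Continuous k) (hτ : Continuous τ)
    {x₀ y₀ z₀ : ℝ} (h₀ : x₀ ^ 2 + y₀ ^ 2 + z₀ ^ 2 = 1) {T : ℝ} (hT : 0 < T) :
    ∃ x y z : ℝ → ℝ, x 0 = x₀ ∧ y 0 = y₀ ∧ z 0 = z₀ ∧
      IsFrenetOn k τ (Set.Ioo (-T) T) x y z := by
  -- The cutoff makes the field globally Lipschitz and bounded, so Picard-Lindelöf applies on all of
  -- `[-T, T]`. It equals `1` on the ball of radius `2`, which contains the unit vectors.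
  let ρ : ContDiffBump (0 : ℝ × ℝ × ℝ) := ⟨2, 3, by norm_num, by norm_num⟩
  let g₁ : ℝ × ℝ × ℝ → ℝ × ℝ × ℝ := fun v => ρ v • (v.2.1, -v.1, (0 : ℝ))
  let g₂ : ℝ × ℝ × ℝ → ℝ × ℝ × ℝ := fun v => ρ v • ((0 : ℝ), v.2.2, -v.2.1)
  have hρ : ContDiff ℝ 1 ρ := ρ.contDiff
  have hg₁ : ContDiff ℝ 1 g₁ := hρ.smul (by fun_prop)
  have hg₂ : ContDiff ℝ 1 g₂ := hρ.smul (by fun_prop)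
  have hs₁ : HasCompactSupport g₁ := ρ.hasCompactSupport.smul_right
  have hs₂ : HasCompactSupport g₂ := ρ.hasCompactSupport.smul_right
  obtain ⟨K₁, hK₁⟩ := hg₁.lipschitzWith_of_hasCompactSupport hs₁ (by simp)
  obtain ⟨K₂, hK₂⟩ := hg₂.lipschitzWith_of_hasCompactSupport hs₂ (by simp)
  obtain ⟨N₁, hN₁⟩ := hs₁.exists_bound_of_continuous hg₁.continuous
  obtain ⟨N₂, hN₂⟩ := hs₂.exists_bound_of_continuous hg₂.continuous
  obtain ⟨P, hP⟩ := isCompact_Icc.exists_bound_of_continuousOn (s := Set.Icc (-T) T) hk.continuousOn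
  obtain ⟨R, hR⟩ := isCompact_Icc.exists_bound_of_continuousOn (s := Set.Icc (-T) T) hτ.continuousOn
  have hT0 : (0 : ℝ) ∈ Set.Icc (-T) T := ⟨by linarith, hT.le⟩
  have hP0 : 0 ≤ P := (norm_nonneg _).trans (hP 0 hT0)
  have hR0 : 0 ≤ R := (norm_nonneg _).trans (hR 0 hT0)
  have hN₁0 : 0 ≤ N₁ := (norm_nonneg _).trans (hN₁ 0)
  have hN₂0 : 0 ≤ N₂ := (norm_nonneg _).trans (hN₂ 0)
  let f : ℝ → ℝ × ℝ × ℝ → ℝ × ℝ × ℝ := fun t v => k t • g₁ v + τ t • g₂ v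
  lift P to NNReal using hP0
  lift R to NNReal using hR0
  lift N₁ to NNReal using hN₁0
  lift N₂ to NNReal using hN₂0
  have hpl : IsPicardLindelof f (⟨0, hT0⟩ : Set.Icc (-T) T) (x₀, y₀, z₀)
      ((P * N₁ + R * N₂) * T.toNNReal) 0 (P * N₁ + R * N₂) (P * K₁ + R * K₂) := by
    refine ⟨fun t ht => ?_, fun v _ => ?_, fun t ht v _ => ?_, ?_⟩
    · refine LipschitzWith.lipschitzOnWith (LipschitzWith.of_dist_le_mul fun v w => ?_)
      have h1 := hK₁.dist_le_mul v w
      have h2 := hK₂.dist_le_mul v w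
      have hp := hP t ht
      have hr := hR t ht
      calc dist (f t v) (f t w) ≤ dist (k t • g₁ v) (k t • g₁ w) + dist (τ t • g₂ v) (τ t • g₂ w) :=
            dist_add_add_le _ _ _ _
        _ = ‖k t‖ * dist (g₁ v) (g₁ w) + ‖τ t‖ * dist (g₂ v) (g₂ w) := by
            rw [dist_smul₀, dist_smul₀]
        _ ≤ P * (K₁ * dist v w) + R * (K₂ * dist v w) := by gcongr
        _ = ((P * K₁ + R * K₂ : NNReal) : ℝ) * dist v w := by
            push_cast
            ring
    · exact Continuous.continuousOn (by fun_prop)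
    · calc ‖f t v‖ ≤ ‖k t • g₁ v‖ + ‖τ t • g₂ v‖ := norm_add_le _ _
        _ = ‖k t‖ * ‖g₁ v‖ + ‖τ t‖ * ‖g₂ v‖ := by rw [norm_smul (k t), norm_smul (τ t)]
        _ ≤ ((P * N₁ + R * N₂ : NNReal) : ℝ) := by
            push_cast
            have := hP t ht
            have := hR t ht
            have := hN₁ v
            have := hN₂ v
            gcongr
    · simp [Real.coe_toNNReal _ hT.le]
  obtain ⟨v, hv0, hv⟩ := hpl.exists_eq_forall_mem_Icc_hasDerivWithinAt₀
  have hv' : ∀ t ∈ Set.Ioo (-T) T, HasDerivAt v (f t (v t)) t := fun t ht =>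
    (hv t (Set.Ioo_subset_Icc_self ht)).hasDerivAt (Icc_mem_nhds ht.1 ht.2)
  have hx : ∀ t ∈ Set.Ioo (-T) T,
      HasDerivAt (fun t => (v t).1) (k t * ρ (v t) * (v t).2.1) t := fun t ht => by
    refine (hasFDerivAt_fst.comp_hasDerivAt t (hv' t ht)).congr_deriv ?_
    simp [f, g₁, g₂]; ring
  have hyz : ∀ t ∈ Set.Ioo (-T) T, HasDerivAt (fun t => (v t).2) (f t (v t)).2 t := fun t ht =>
    (hasFDerivAt_snd.comp_hasDerivAt t (hv' t ht)).congr_deriv rfl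
  have hy : ∀ t ∈ Set.Ioo (-T) T, HasDerivAt (fun t => (v t).2.1)
      (-(k t * ρ (v t) * (v t).1) + τ t * ρ (v t) * (v t).2.2) t := fun t ht => by
    refine (hasFDerivAt_fst.comp_hasDerivAt t (hyz t ht)).congr_deriv ?_
    simp [f, g₁, g₂]; ring
  have hz : ∀ t ∈ Set.Ioo (-T) T,
      HasDerivAt (fun t => (v t).2.2) (-(τ t * ρ (v t) * (v t).2.1)) t := fun t ht => by
    refine (hasFDerivAt_snd.comp_hasDerivAt t (hyz t ht)).congr_deriv ?_
    simp [f, g₁, g₂]; ring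
  -- Along the solution the cutoff only rescales `k` and `τ`, so the truncated system is again of
  -- Serret-Frenet type. Its norm is conserved and the cutoff is never felt.
  have hF : IsFrenetOn (fun t => k t * ρ (v t)) (fun t => τ t * ρ (v t)) (Set.Ioo (-T) T)
    (fun t => (v t).1) (fun t => (v t).2.1) (fun t => (v t).2.2) := ⟨hx, hy, hz⟩
  have hT0' : (0 : ℝ) ∈ Set.Ioo (-T) T := ⟨by linarith, hT⟩
  have hone : ∀ t ∈ Set.Ioo (-T) T, ρ (v t) = 1 := fun t ht => by
    have e := hF.inner_const hF isOpen_Ioo isPreconnected_Ioo ht hT0'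
    simp only [hv0] at e
    refine ρ.one_of_mem_closedBall ?_
    rw [mem_closedBall_zero_iff, Prod.norm_def, Prod.norm_def]
    simp only [Real.norm_eq_abs, sup_le_iff, ρ]
    refine ⟨?_, ?_, ?_⟩ <;> refine abs_le_of_sq_le_sq ?_ (by norm_num) <;>
      nlinarith [sq_nonneg (v t).1, sq_nonneg (v t).2.1, sq_nonneg (v t).2.2]
  refine ⟨fun t => (v t).1, fun t => (v t).2.1, fun t => (v t).2.2, by simp [hv0], by simp [hv0],
    by simp [hv0], fun t ht => ?_, fun t ht => ?_, fun t ht => ?_⟩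
  · simpa [hone t ht] using hx t ht
  · simpa [hone t ht] using hy t ht
  · simpa [hone t ht] using hz t ht

/-- Global solvability of the Serret-Frenet system with continuous curvature and torsion. -/
lemma exists_isFrenetOn_univ {k τ : ℝ → ℝ} (hk : Continuous k) (hτ : Continuous τ)
    {x₀ y₀ z₀ : ℝ} (h₀ : x₀ ^ 2 + y₀ ^ 2 + z₀ ^ 2 = 1) :
    ∃ x y z : ℝ → ℝ, x 0 = x₀ ∧ y 0 = y₀ ∧ z 0 = z₀ ∧ IsFrenetOn k τ Set.univ x y z := by
  have hpos : ∀ t : ℝ, 0 < |t| + 1 := fun t => by positivity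
  choose x y z hx0 hy0 hz0 h using fun T : {T : ℝ // 0 < T} =>
    exists_isFrenetOn_Ioo hk hτ h₀ T.2
  -- Gluing: the value at `t` is read off from the solution on the interval of radius `|t| + 1`;
  -- uniqueness on the smaller of two intervals makes the choice irrelevant.
  have key : ∀ (S : {T : ℝ // 0 < T}) (t : ℝ), t ∈ Set.Ioo (-S.1) S.1 →
      x ⟨|t| + 1, hpos t⟩ t = x S t ∧ y ⟨|t| + 1, hpos t⟩ t = y S t ∧
        z ⟨|t| + 1, hpos t⟩ t = z S t := fun S t ht => by
    have h1 := (h ⟨|t| + 1, hpos t⟩).mono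
      (V := Set.Ioo (-min (|t| + 1) S.1) (min (|t| + 1) S.1))
      (Set.Ioo_subset_Ioo (neg_le_neg (min_le_left _ _)) (min_le_left _ _))
    have h2 := (h S).mono
      (V := Set.Ioo (-min (|t| + 1) S.1) (min (|t| + 1) S.1))
      (Set.Ioo_subset_Ioo (neg_le_neg (min_le_right _ _)) (min_le_right _ _))
    have hm : 0 < min (|t| + 1) S.1 := lt_min (hpos t) S.2
    refine h1.unique h2 isOpen_Ioo isPreconnected_Ioo (t₀ := 0) ⟨by linarith, hm⟩ ?_
      (by rw [hx0, hx0]) (by rw [hy0, hy0]) (by rw [hz0, hz0])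
    rw [Set.mem_Ioo, ← abs_lt]
    exact lt_min (by linarith) (abs_lt.2 ht)
  have hev : ∀ t : ℝ, ∀ᶠ s in 𝓝 t, s ∈ Set.Ioo (-(|t| + 1)) (|t| + 1) := fun t =>
    isOpen_Ioo.mem_nhds ⟨by linarith [neg_abs_le t], by linarith [le_abs_self t]⟩
  have hself : ∀ t : ℝ, t ∈ Set.Ioo (-(|t| + 1)) (|t| + 1) := fun t => (hev t).self_of_nhds
  refine ⟨fun t => x ⟨|t| + 1, hpos t⟩ t, fun t => y ⟨|t| + 1, hpos t⟩ t,
    fun t => z ⟨|t| + 1, hpos t⟩ t, hx0 _, hy0 _, hz0 _, fun t _ => ?_, fun t _ => ?_,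
    fun t _ => ?_⟩
  · exact ((h ⟨|t| + 1, hpos t⟩).dx t (hself t)).congr_of_eventuallyEq
      ((hev t).mono fun s hs => (key ⟨|t| + 1, hpos t⟩ s hs).1)
  · exact ((h ⟨|t| + 1, hpos t⟩).dy t (hself t)).congr_of_eventuallyEq
      ((hev t).mono fun s hs => (key ⟨|t| + 1, hpos t⟩ s hs).2.1)
  · exact ((h ⟨|t| + 1, hpos t⟩).dz t (hself t)).congr_of_eventuallyEq
      ((hev t).mono fun s hs => (key ⟨|t| + 1, hpos t⟩ s hs).2.2)

/-! ### The tangent component: integration by parts up to order three. -/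

/-- A function whose derivative is dominated by that of a decreasing function tending to zero
converges, with the corresponding rate. -/
lemma exists_tendsto_of_deriv_bound {f : ℝ → ℂ} {g g' : ℝ → ℝ}
    (hf : ∀ s, 1 ≤ s → ∃ f', HasDerivAt f f' s ∧ ‖f'‖ ≤ g' s)
    (hg : ∀ s, 1 ≤ s → HasDerivAt g (-g' s) s) (h0 : Tendsto g atTop (𝓝 0)) :
    ∃ L, Tendsto f atTop (𝓝 L) ∧ ∀ s, 1 ≤ s → ‖f s - L‖ ≤ g s := by
  have key : ∀ s t, 1 ≤ s → s ≤ t → ‖f t - f s‖ ≤ g s - g t := by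
    intro s t hs hst
    choose! f' hf' hb using hf
    refine image_norm_le_of_norm_deriv_right_le_deriv_boundary' (f := fun t => f t - f s)
      (f' := f') (B := fun t => g s - g t) (B' := g') (a := s) (b := t) ?_ ?_ (by simp) ?_ ?_ ?_
      ⟨hst, le_rfl⟩
    · exact fun x hx =>
        ((hf' x (hs.trans hx.1)).continuousAt.sub continuousAt_const).continuousWithinAt
    · exact fun x hx => ((hf' x (hs.trans hx.1)).sub_const _).hasDerivWithinAt
    · exact fun x hx =>
        (continuousAt_const.sub (hg x (hs.trans hx.1)).continuousAt).continuousWithinAt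
    · intro x hx
      exact (((hg x (hs.trans hx.1)).const_sub (g s)).congr_deriv (neg_neg _)).hasDerivWithinAt
    · exact fun x hx => hb x (hs.trans hx.1)
  have hg0 : ∀ s, 1 ≤ s → ∀ t, s ≤ t → 0 ≤ g t := by
    intro s hs t hst
    refine ge_of_tendsto_of_frequently (tendsto_const_nhds.sub h0 |>.congr fun _ => rfl) ?_ |>.trans
      (le_of_eq (sub_zero (g t)))
    refine (eventually_ge_atTop t).frequently.mono fun u hu => ?_
    exact (norm_nonneg _).trans (key t u (hs.trans hst) hu)
  have hc : CauchySeq f := by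
    rw [Metric.cauchySeq_iff']
    intro ε hε
    obtain ⟨N, hN1, hN⟩ :=
      ((eventually_ge_atTop 1).and (h0.eventually (gt_mem_nhds hε))).exists
    refine ⟨N, fun t ht => ?_⟩
    rw [dist_eq_norm]
    linarith [key N t hN1 ht, hg0 N hN1 t ht]
  obtain ⟨L, hL⟩ := cauchySeq_tendsto_of_complete hc
  refine ⟨L, hL, fun s hs => ?_⟩
  have ht : Tendsto (fun t => ‖f t - f s‖) atTop (𝓝 ‖L - f s‖) := (hL.sub_const _).norm
  rw [norm_sub_rev]
  refine le_of_tendsto ht ((eventually_ge_atTop s).mono fun t hst => ?_)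
  linarith [key s t hs hst, hg0 s hs t hst]

/-- The scalar Serret-Frenet system in the frame rotated by the torsion: `x` is the tangent
component, `M` the rotated complex normal component, `E` the oscillating Gaussian, and `Eb`, `Mb`
stand for the conjugates. -/
structure IsRotated (c α : ℝ) (ζ ζb : ℂ) (x E Eb M Mb : ℝ → ℂ) : Prop where
  dx : ∀ s, HasDerivAt x (c / 2 * (Eb s * M s + E s * Mb s)) s
  dM : ∀ s, HasDerivAt M (-(c * x s * E s)) s
  dMb : ∀ s, HasDerivAt Mb (-(c * x s * Eb s)) s
  dE : ∀ s : ℝ, HasDerivAt E (ζ / 2 * s * E s) s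
  dEb : ∀ s : ℝ, HasDerivAt Eb (ζb / 2 * s * Eb s) s
  mul_eq : ζ * ζb = 1
  add_eq : ζ + ζb = -2 * α
  norm_ζ : ‖ζ‖ = 1
  norm_ζb : ‖ζb‖ = 1
  norm_x : ∀ s, ‖x s‖ ≤ 1
  norm_M : ∀ s, ‖M s‖ ≤ 1
  norm_Mb : ∀ s, ‖Mb s‖ ≤ 1
  norm_E : ∀ s, ‖E s‖ = Real.exp (-α * s ^ 2 / 4)
  norm_Eb : ∀ s, ‖Eb s‖ = Real.exp (-α * s ^ 2 / 4)

lemma hasDerivAt_ofReal_inv {s : ℝ} (hs : s ≠ 0) :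
    HasDerivAt (fun t : ℝ => ((t⁻¹ : ℝ) : ℂ)) (-((s⁻¹ : ℝ) : ℂ) ^ 2) s := by
  refine (hasDerivAt_inv hs).ofReal_comp.congr_deriv ?_
  push_cast
  ring

lemma hasDerivAt_gaussian (α s : ℝ) :
    HasDerivAt (fun t : ℝ => Real.exp (-α * t ^ 2 / 4))
      (-(α / 2 * s) * Real.exp (-α * s ^ 2 / 4)) s := by
  have h : HasDerivAt (fun t : ℝ => -α * t ^ 2 / 4) (-(α / 2 * s)) s := by
    refine (((hasDerivAt_pow 2 s).const_mul (-α)).div_const 4).congr_deriv ?_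
    push_cast
    ring
  exact h.exp.congr_deriv (by ring)

/-- The comparison function for all error terms. Its derivative offers two budgets, `α s⁻ⁿ` and
`s⁻⁽ⁿ⁺²⁾`, both times the Gaussian; sorting errors into these two is what keeps constants uniform in
`α`. -/
lemma hasDerivAt_gaussian_mul_inv_pow (α K : ℝ) (n : ℕ) {s : ℝ} (hs : s ≠ 0) :
    HasDerivAt (fun t : ℝ => K * (Real.exp (-α * t ^ 2 / 4) * t⁻¹ ^ (n + 1)))
      (-(K * ((α / 2 * s⁻¹ ^ n + (n + 1) * s⁻¹ ^ (n + 2)) * Real.exp (-α * s ^ 2 / 4)))) s := by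
  refine (((hasDerivAt_gaussian α s).mul
    ((hasDerivAt_inv hs).pow (n + 1))).const_mul K).congr_deriv ?_
  have h : s * s⁻¹ = 1 := mul_inv_cancel₀ hs
  have h2 : -(s ^ 2)⁻¹ = -s⁻¹ ^ 2 := by rw [inv_pow]
  rw [h2]
  push_cast
  simp only [Pi.pow_apply]
  linear_combination (-(K * α / 2 * s⁻¹ ^ n * Real.exp (-α * s ^ 2 / 4))) * h

lemma gaussian_le_one {α : ℝ} (hα : 0 ≤ α) (s : ℝ) : Real.exp (-α * s ^ 2 / 4) ≤ 1 :=
  Real.exp_le_one_iff.2 (by nlinarith [mul_nonneg hα (sq_nonneg s)])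

lemma tendsto_gaussian_mul_inv_pow {α : ℝ} (hα : 0 ≤ α) (K : ℝ) (n : ℕ) :
    Tendsto (fun t : ℝ => K * (Real.exp (-α * t ^ 2 / 4) * t⁻¹ ^ (n + 1))) atTop (𝓝 0) := by
  have h : Tendsto (fun t : ℝ => t⁻¹ ^ (n + 1)) atTop (𝓝 0) := by
    simpa using (tendsto_inv_atTop_zero (𝕜 := ℝ)).pow (n + 1)
  have h2 : Tendsto (fun t : ℝ => Real.exp (-α * t ^ 2 / 4) * t⁻¹ ^ (n + 1)) atTop (𝓝 0) := by
    refine squeeze_zero' ?_ ?_ h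
    · filter_upwards [eventually_gt_atTop 0] with t ht
      positivity
    · filter_upwards [eventually_gt_atTop 0] with t ht
      exact mul_le_of_le_one_left (by positivity) (gaussian_le_one hα t)
  simpa using h2.const_mul K

namespace IsRotated

variable {c α : ℝ} {ζ ζb : ℂ} {x E Eb M Mb : ℝ → ℂ}

lemma norm_osc (h : IsRotated c α ζ ζb x E Eb M Mb) {M' Mb' : ℂ} {B s : ℝ}
    (hM : ‖M'‖ ≤ B) (hMb : ‖Mb'‖ ≤ B) (n : ℕ) :
    ‖ζ ^ n * (Eb s * M') + ζb ^ n * (E s * Mb')‖ ≤ 2 * B * Real.exp (-α * s ^ 2 / 4) := by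
  refine (norm_add_le _ _).trans ?_
  simp only [norm_mul, norm_pow, h.norm_ζ, h.norm_ζb, one_pow, one_mul, h.norm_E, h.norm_Eb]
  have he := Real.exp_nonneg (-α * s ^ 2 / 4)
  nlinarith [mul_le_mul_of_nonneg_left hM he, mul_le_mul_of_nonneg_left hMb he]

lemma hasDerivAt_EbM (h : IsRotated c α ζ ζb x E Eb M Mb) (n : ℕ) (s : ℝ) :
    HasDerivAt (fun s => ζ ^ n * (Eb s * M s) + ζb ^ n * (E s * Mb s))
      (s / 2 * (ζ ^ n * ζb * (Eb s * M s) + ζb ^ n * ζ * (E s * Mb s))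
        - c * (ζ ^ n + ζb ^ n) * x s * (E s * Eb s)) s := by
  refine ((((h.dEb s).mul (h.dM s)).const_mul (ζ ^ n)).add
    (((h.dE s).mul (h.dMb s)).const_mul (ζb ^ n))).congr_deriv ?_
  ring

/-- One integration by parts: `ζ ζ̄ = 1` cancels the leading oscillation of `x'`. What survives
either decays like `s⁻²` or carries the factor `α`, which comes from `ζ + ζ̄ = -2α` in the product
of `Ē` with `M'` and its conjugate. -/
lemma hasDerivAt_stage_one (h : IsRotated c α ζ ζb x E Eb M Mb) {s : ℝ} (hs : s ≠ 0) :
    HasDerivAt (fun s => x s - c * (ζ ^ 1 * (Eb s * M s) + ζb ^ 1 * (E s * Mb s)) * (s⁻¹ : ℝ))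
      (c * (ζ ^ 1 * (Eb s * M s) + ζb ^ 1 * (E s * Mb s)) * (s⁻¹ : ℝ) ^ 2
        - 2 * α * c ^ 2 * x s * (E s * Eb s) * (s⁻¹ : ℝ)) s := by
  refine ((h.dx s).sub
    (((h.hasDerivAt_EbM 1 s).const_mul (c : ℂ)).mul (hasDerivAt_ofReal_inv hs))).congr_deriv ?_
  have h1 := h.mul_eq
  have h2 := h.add_eq
  have h3 : (s : ℂ) * ((s⁻¹ : ℝ) : ℂ) = 1 := by
    rw [← Complex.ofReal_mul, mul_inv_cancel₀ hs, Complex.ofReal_one]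
  generalize ((s⁻¹ : ℝ) : ℂ) = i at *
  linear_combination (-(c / 2 * (Eb s * M s + E s * Mb s)) * s * i) * h1
    - (c / 2 * (Eb s * M s + E s * Mb s)) * h3 + c ^ 2 * x s * (E s * Eb s) * i * h2

lemma exists_limit (h : IsRotated c α ζ ζb x E Eb M Mb) (hc : 0 ≤ c) (hα : 0 ≤ α) :
    ∃ A, Tendsto x atTop (𝓝 A) ∧
      Tendsto (fun s => x s - c * (ζ ^ 1 * (Eb s * M s) + ζb ^ 1 * (E s * Mb s)) * (s⁻¹ : ℝ))
        atTop (𝓝 A) ∧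
      ∀ s, 1 ≤ s → ‖x s - A‖ ≤ (4 * c + 4 * c ^ 2) * (Real.exp (-α * s ^ 2 / 4) * s⁻¹) := by
  have hd : ∀ s, 1 ≤ s → ∃ f', HasDerivAt (fun s => x s -
      c * (ζ ^ 1 * (Eb s * M s) + ζb ^ 1 * (E s * Mb s)) * (s⁻¹ : ℝ)) f' s ∧
      ‖f'‖ ≤ (2 * c + 4 * c ^ 2) * ((α / 2 * s⁻¹ ^ 0 + ((0 : ℕ) + 1) * s⁻¹ ^ (0 + 2)) *
        Real.exp (-α * s ^ 2 / 4)) := fun s hs => by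
    refine ⟨_, h.hasDerivAt_stage_one (by positivity), ?_⟩
    have hi : 0 ≤ s⁻¹ := by positivity
    have hi1 : s⁻¹ ≤ 1 := inv_le_one_of_one_le₀ hs
    have hosc := h.norm_osc (s := s) (h.norm_M s) (h.norm_Mb s) 1
    have hx := h.norm_x s
    have he := gaussian_le_one hα s
    have he0 := Real.exp_nonneg (-α * s ^ 2 / 4)
    refine (norm_sub_le _ _).trans ?_
    simp only [norm_mul, norm_pow, Complex.norm_real, Real.norm_of_nonneg hc,
      Real.norm_of_nonneg hi, Real.norm_of_nonneg hα, h.norm_E, h.norm_Eb, Complex.norm_ofNat]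
    generalize Real.exp (-α * s ^ 2 / 4) = e at *
    -- In the term with `α` one Gaussian factor and `s⁻¹` are dropped, since the budget only asks
    -- for `α e`.
    calc _ ≤ c * (2 * 1 * e) * s⁻¹ ^ 2 + 2 * α * c ^ 2 * 1 * (e * 1) * 1 := by gcongr
      _ ≤ _ := by
        push_cast
        have : 0 ≤ c ^ 2 * e * s⁻¹ ^ 2 := by positivity
        have : 0 ≤ c * α * e := by positivity
        simp only [pow_zero, zero_add]
        linarith
  obtain ⟨A, hA, hb⟩ := exists_tendsto_of_deriv_bound hd
    (fun s hs => hasDerivAt_gaussian_mul_inv_pow _ _ _ (by positivity))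
    (tendsto_gaussian_mul_inv_pow hα _ _)
  have hosc : ∀ s, 1 ≤ s → ‖c * (ζ ^ 1 * (Eb s * M s) + ζb ^ 1 * (E s * Mb s)) * (s⁻¹ : ℝ)‖
      ≤ 2 * c * (Real.exp (-α * s ^ 2 / 4) * s⁻¹) := fun s hs => by
    have hi : 0 ≤ s⁻¹ := by positivity
    simp only [norm_mul, Complex.norm_real, Real.norm_of_nonneg hc, Real.norm_of_nonneg hi]
    have := h.norm_osc (s := s) (h.norm_M s) (h.norm_Mb s) 1
    calc _ ≤ c * (2 * 1 * Real.exp (-α * s ^ 2 / 4)) * s⁻¹ := by gcongr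
      _ = _ := by ring
  have hosc0 : Tendsto (fun s => c * (ζ ^ 1 * (Eb s * M s) + ζb ^ 1 * (E s * Mb s)) * (s⁻¹ : ℝ))
      atTop (𝓝 0) := by
    refine squeeze_zero_norm' ((eventually_ge_atTop 1).mono hosc) ?_
    simpa using tendsto_gaussian_mul_inv_pow hα (2 * c) 0
  refine ⟨A, by simpa using hA.add hosc0, hA, fun s hs => ?_⟩
  have h1 := hb s hs
  have h2 := hosc s hs
  rw [show s⁻¹ ^ (0 + 1) = s⁻¹ from pow_one _] at h1
  calc ‖x s - A‖ = ‖(x s - c * (ζ ^ 1 * (Eb s * M s) + ζb ^ 1 * (E s * Mb s)) * (s⁻¹ : ℝ) - A)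
        + c * (ζ ^ 1 * (Eb s * M s) + ζb ^ 1 * (E s * Mb s)) * (s⁻¹ : ℝ)‖ := by ring_nf
    _ ≤ _ := (norm_add_le _ _).trans (by linarith)

end IsRotated

lemma ofReal_mul_inv {s : ℝ} (hs : s ≠ 0) : (s : ℂ) * ((s⁻¹ : ℝ) : ℂ) = 1 := by
  rw [← Complex.ofReal_mul, mul_inv_cancel₀ hs, Complex.ofReal_one]

namespace IsRotated

variable {c α : ℝ} {ζ ζb : ℂ} {x E Eb M Mb : ℝ → ℂ}

lemma hasDerivAt_D (h : IsRotated c α ζ ζb x E Eb M Mb) (s : ℝ) :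
    HasDerivAt (fun s => E s * Eb s) (-(α * s) * (E s * Eb s)) s := by
  refine ((h.dE s).mul (h.dEb s)).congr_deriv ?_
  linear_combination (s / 2 * (E s * Eb s)) * h.add_eq

/-- Derivative of the tangent component minus all explicit terms up to order two. -/
lemma hasDerivAt_stage_two (h : IsRotated c α ζ ζb x E Eb M Mb) (A : ℂ) {s : ℝ} (hs : s ≠ 0) :
    HasDerivAt (fun s => (x s - c * (ζ ^ 1 * (Eb s * M s) + ζb ^ 1 * (E s * Mb s)) * (s⁻¹ : ℝ))
        - 2 * c * (ζ ^ 2 * (Eb s * M s) + ζb ^ 2 * (E s * Mb s)) * (s⁻¹ : ℝ) ^ 3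
        - 2 * c ^ 2 * A * (E s * Eb s) * (s⁻¹ : ℝ) ^ 2)
      (-(2 * c ^ 2 * ((x s - A) * (α * (s⁻¹ : ℝ) + 2 * (s⁻¹ : ℝ) ^ 3) * (E s * Eb s)))
        + 8 * c ^ 2 * α ^ 2 * (x s * (E s * Eb s)) * (s⁻¹ : ℝ) ^ 3
        + 6 * c * (ζ ^ 2 * (Eb s * M s) + ζb ^ 2 * (E s * Mb s)) * (s⁻¹ : ℝ) ^ 4) s := by
  have hi := hasDerivAt_ofReal_inv hs
  refine (((h.hasDerivAt_stage_one hs).sub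
    (((h.hasDerivAt_EbM 2 s).const_mul (2 * c : ℂ)).mul (hi.pow 3))).sub
    (((h.hasDerivAt_D s).const_mul (2 * c ^ 2 * A)).mul (hi.pow 2))).congr_deriv ?_
  have h1 := h.mul_eq
  -- The summand `-2` produces a term in `x |E|² s⁻³` that joins the derivative of the `A |E|² s⁻²`
  -- correction, so that only `x - A` occurs; the summand `4α²` is small enough to be kept as an
  -- error.
  have h2 : ζ ^ 2 + ζb ^ 2 = 4 * α ^ 2 - 2 := by
    linear_combination (ζ + ζb - 2 * α) * h.add_eq - 2 * h1
  have h3 := ofReal_mul_inv hs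
  simp only [Pi.pow_apply]
  generalize ((s⁻¹ : ℝ) : ℂ) = i at *
  push_cast
  linear_combination (2 * c ^ 2 * x s * (E s * Eb s) * i ^ 3) * h2
    - (c * s * i ^ 3 * (ζ * (Eb s * M s) + ζb * (E s * Mb s))) * h1
    - (c * i ^ 2 * (ζ * (Eb s * M s) + ζb * (E s * Mb s))) * h3
    + (2 * c ^ 2 * A * α * (E s * Eb s) * i) * h3

/-- The already known rate of `x - A` gains one more factor `s⁻¹`, so the derivative of the twice
corrected component fits the budgets `α s⁻²` and `s⁻⁴`. -/
lemma norm_stage_two_le (h : IsRotated c α ζ ζb x E Eb M Mb) (hc : 0 ≤ c)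
    (hα : α ∈ Set.Icc (0 : ℝ) 1) {A : ℂ}
    (hA : Tendsto (fun s => x s - c * (ζ ^ 1 * (Eb s * M s) + ζb ^ 1 * (E s * Mb s)) * (s⁻¹ : ℝ))
      atTop (𝓝 A)) {K : ℝ} (hK : 0 ≤ K)
    (hxA : ∀ s, 1 ≤ s → ‖x s - A‖ ≤ K * (Real.exp (-α * s ^ 2 / 4) * s⁻¹)) (hA1 : ‖A‖ ≤ 1)
    {s : ℝ} (hs : 1 ≤ s) :
    ‖(x s - c * (ζ ^ 1 * (Eb s * M s) + ζb ^ 1 * (E s * Mb s)) * (s⁻¹ : ℝ))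
        - 2 * c * (ζ ^ 2 * (Eb s * M s) + ζb ^ 2 * (E s * Mb s)) * (s⁻¹ : ℝ) ^ 3
        - 2 * c ^ 2 * A * (E s * Eb s) * (s⁻¹ : ℝ) ^ 2 - A‖ ≤
      (12 * c + 16 * c ^ 2 + 8 * c ^ 2 * K) * (Real.exp (-α * s ^ 2 / 4) * s⁻¹ ^ 3) := by
  have hd : ∀ s, 1 ≤ s → ∃ f', HasDerivAt
      (fun s => (x s - c * (ζ ^ 1 * (Eb s * M s) + ζb ^ 1 * (E s * Mb s)) * (s⁻¹ : ℝ))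
        - 2 * c * (ζ ^ 2 * (Eb s * M s) + ζb ^ 2 * (E s * Mb s)) * (s⁻¹ : ℝ) ^ 3
        - 2 * c ^ 2 * A * (E s * Eb s) * (s⁻¹ : ℝ) ^ 2) f' s ∧
      ‖f'‖ ≤ (12 * c + 16 * c ^ 2 + 8 * c ^ 2 * K) *
        ((α / 2 * s⁻¹ ^ 2 + ((2 : ℕ) + 1) * s⁻¹ ^ (2 + 2)) * Real.exp (-α * s ^ 2 / 4)) := by
    intro s hs
    refine ⟨_, h.hasDerivAt_stage_two A (by positivity), ?_⟩
    have hi : 0 ≤ s⁻¹ := by positivity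
    have hi1 : s⁻¹ ≤ 1 := inv_le_one_of_one_le₀ hs
    have hosc := h.norm_osc (s := s) (h.norm_M s) (h.norm_Mb s) 2
    have hx := h.norm_x s
    have hxs := hxA s hs
    have he := gaussian_le_one hα.1 s
    have he0 := Real.exp_nonneg (-α * s ^ 2 / 4)
    have hα0 := hα.1
    have hα1 := hα.2
    have h2 : ‖(α * (s⁻¹ : ℝ) + 2 * (s⁻¹ : ℝ) ^ 3 : ℂ)‖ = α * s⁻¹ + 2 * s⁻¹ ^ 3 := by
      rw [← Real.norm_of_nonneg (show 0 ≤ α * s⁻¹ + 2 * s⁻¹ ^ 3 by positivity),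
        ← Complex.norm_real]
      push_cast
      rfl
    refine (norm_add₃_le ..).trans ?_
    simp only [norm_neg, norm_mul, norm_pow, Complex.norm_real, Real.norm_of_nonneg hc, h2,
      Real.norm_of_nonneg hi, Real.norm_of_nonneg hα0, h.norm_E, h.norm_Eb, Complex.norm_ofNat]
    generalize Real.exp (-α * s ^ 2 / 4) = e at *
    generalize s⁻¹ = i at *
    calc _ ≤ 2 * c ^ 2 * ((K * (e * i)) * (α * i + 2 * i ^ 3) * (e * 1))
          + 8 * c ^ 2 * (α * 1) * (1 * (e * 1)) * (i ^ 2 * 1) + 6 * c * (2 * 1 * e) * i ^ 4 := by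
          -- Here `α² s⁻³` is weakened to `α s⁻²`, using `α ≤ 1` and `s⁻¹ ≤ 1`.
          rw [sq α, pow_succ i 2]
          gcongr
      _ ≤ 2 * c ^ 2 * ((K * (1 * i)) * (α * i + 2 * i ^ 3) * (e * 1))
          + 8 * c ^ 2 * (α * 1) * (1 * (e * 1)) * (i ^ 2 * 1) + 6 * c * (2 * 1 * e) * i ^ 4 := by
          gcongr
      _ ≤ _ := by
        have : 0 ≤ c ^ 2 * K * i ^ 2 * α * e := by positivity
        have : 0 ≤ c ^ 2 * K * i ^ 4 * e := by positivity
        have : 0 ≤ c ^ 2 * i ^ 4 * e := by positivity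
        have : 0 ≤ c * i ^ 4 * e := by positivity
        have : 0 ≤ c * α * i ^ 2 * e := by positivity
        push_cast
        linarith
  obtain ⟨L, hL, hb⟩ := exists_tendsto_of_deriv_bound hd
    (fun s hs => hasDerivAt_gaussian_mul_inv_pow _ _ _ (by positivity))
    (tendsto_gaussian_mul_inv_pow hα.1 _ _)
  have hT : Tendsto (fun s : ℝ =>
      (x s - c * (ζ ^ 1 * (Eb s * M s) + ζb ^ 1 * (E s * Mb s)) * (s⁻¹ : ℝ))
        - 2 * c * (ζ ^ 2 * (Eb s * M s) + ζb ^ 2 * (E s * Mb s)) * (s⁻¹ : ℝ) ^ 3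
        - 2 * c ^ 2 * A * (E s * Eb s) * (s⁻¹ : ℝ) ^ 2) atTop (𝓝 (A - 0 - 0)) := by
    refine (hA.sub ?_).sub ?_
    · refine squeeze_zero_norm' ?_ (tendsto_gaussian_mul_inv_pow hα.1 (4 * c) 2)
      filter_upwards [eventually_ge_atTop 1] with s hs
      have hi : 0 ≤ s⁻¹ := by positivity
      have hosc := h.norm_osc (s := s) (h.norm_M s) (h.norm_Mb s) 2
      simp only [norm_mul, norm_pow, Complex.norm_real, Real.norm_of_nonneg hc,
        Real.norm_of_nonneg hi, Complex.norm_ofNat]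
      calc _ ≤ 2 * c * (2 * 1 * Real.exp (-α * s ^ 2 / 4)) * s⁻¹ ^ 3 := by gcongr
        _ = _ := by ring
    · refine squeeze_zero_norm' ?_ (tendsto_gaussian_mul_inv_pow hα.1 (2 * c ^ 2) 1)
      filter_upwards [eventually_ge_atTop 1] with s hs
      have hi : 0 ≤ s⁻¹ := by positivity
      have he := gaussian_le_one hα.1 s
      have he0 := Real.exp_nonneg (-α * s ^ 2 / 4)
      simp only [norm_mul, norm_pow, Complex.norm_real, Real.norm_of_nonneg hc,
        Real.norm_of_nonneg hi, Complex.norm_ofNat, h.norm_E, h.norm_Eb]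
      calc _ ≤ 2 * c ^ 2 * 1 * (Real.exp (-α * s ^ 2 / 4) * 1) * s⁻¹ ^ 2 := by gcongr
        _ = _ := by ring
  rw [sub_zero, sub_zero] at hT
  obtain rfl := tendsto_nhds_unique hT hL
  exact hb s hs

/-! ### The normal component: removing oscillations and compensating the phase. -/

/-- The complex normal component with its oscillating corrections of order one to three. -/
noncomputable def corrected (c : ℝ) (ζ ζb : ℂ) (x E Eb M Mb : ℝ → ℂ) (s : ℝ) : ℂ :=
  M s + 2 * c * ζb * (x s * E s) * (s⁻¹ : ℝ) - c ^ 2 * ζb ^ 2 * (E s ^ 2 * Mb s) * (s⁻¹ : ℝ) ^ 2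
    + 4 * c * ζb ^ 2 * (x s * E s) * (s⁻¹ : ℝ) ^ 3
    + 2 * c ^ 3 * ζb ^ 2 * (2 * ζ + ζb)⁻¹ * (x s * (E s * Eb s) * E s) * (s⁻¹ : ℝ) ^ 3

/-- The frequency of `|E|² E` is proportional to `2ζ + ζ̄`, with real part `-3α` and imaginary part
that of `ζ`, so its modulus is at least `|ζ| = 1`. This allows division by it uniformly in `α`. -/
lemma one_le_norm_omega (h : IsRotated c α ζ ζb x E Eb M Mb)
    (hζ : ζb = starRingEnd ℂ ζ) : 1 ≤ ‖2 * ζ + ζb‖ := by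
  have h1 : ζ.re = -α := by
    have := congrArg Complex.re h.add_eq
    simp [hζ] at this
    linarith
  have h2 : ζ.re ^ 2 + ζ.im ^ 2 = 1 := by
    have := Complex.sq_norm ζ
    rw [h.norm_ζ, Complex.normSq_apply] at this
    linarith
  have h3 : (1 : ℝ) ≤ ‖2 * ζ + ζb‖ ^ 2 := by
    rw [Complex.sq_norm, Complex.normSq_apply, hζ]
    simp
    nlinarith [sq_nonneg ζ.re]
  nlinarith [norm_nonneg (2 * ζ + ζb)]

/-- The remainder in the evolution equation of the corrected normal component. -/
noncomputable def remainder (c : ℝ) (ζ ζb : ℂ) (x E Eb M Mb : ℝ → ℂ) (s : ℝ) : ℂ :=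
  2 * c ^ 2 * ζb ^ 2 * (E s ^ 2 * Mb s)
    + 4 * c * ζb ^ 2 * (c / 2 * (Eb s * M s + E s * Mb s) * E s - 3 * (x s * E s) * (s⁻¹ : ℝ))
    + 2 * c ^ 3 * ζb ^ 2 * (2 * ζ + ζb)⁻¹ * (c / 2 * (Eb s * M s + E s * Mb s) * (E s * Eb s) * E s
        - 3 * (x s * (E s * Eb s) * E s) * (s⁻¹ : ℝ))
    - c ^ 2 * ζb * (E s * Eb s) * (-(c ^ 2 * ζb ^ 2 * (E s ^ 2 * Mb s))
        + 4 * c * ζb ^ 2 * (x s * E s) * (s⁻¹ : ℝ)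
        + 2 * c ^ 3 * ζb ^ 2 * (2 * ζ + ζb)⁻¹ * (x s * (E s * Eb s) * E s) * (s⁻¹ : ℝ))

/-- Each correction integrates one oscillating term: `x E` at first order, then `E² M̄`, `x E`
again, and `x |E|² E`, of frequencies `ζ`, `2ζ`, `ζ` and `2ζ + ζ̄` up to a common factor. Only the
resonant product `E Ē M` cannot be removed; it becomes the linear term. -/
lemma hasDerivAt_corrected (h : IsRotated c α ζ ζb x E Eb M Mb) (hω : 2 * ζ + ζb ≠ 0)
    {s : ℝ} (hs : s ≠ 0) :
    HasDerivAt (corrected c ζ ζb x E Eb M Mb)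
      (c ^ 2 * ζb * (E s * Eb s) * (s⁻¹ : ℝ) * corrected c ζ ζb x E Eb M Mb s
        + remainder c ζ ζb x E Eb M Mb s * (s⁻¹ : ℝ) ^ 3) s := by
  have hi := hasDerivAt_ofReal_inv hs
  have hxE := (h.dx s).mul (h.dE s)
  have hxDE := ((h.dx s).mul (h.hasDerivAt_D s)).mul (h.dE s)
  refine (((((h.dM s).add ((hxE.const_mul (2 * c * ζb)).mul hi)).sub
    (((((h.dE s).pow 2).mul (h.dMb s)).const_mul (c ^ 2 * ζb ^ 2)).mul (hi.pow 2))).add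
    ((hxE.const_mul (4 * c * ζb ^ 2)).mul (hi.pow 3))).add
    ((hxDE.const_mul (2 * c ^ 3 * ζb ^ 2 * (2 * ζ + ζb)⁻¹)).mul (hi.pow 3))).congr_deriv ?_
  have h1 := h.mul_eq
  have h2 := h.add_eq
  have h3 := ofReal_mul_inv hs
  have h4 : (2 * ζ + ζb) * (2 * ζ + ζb)⁻¹ = 1 := mul_inv_cancel₀ hω
  simp only [Pi.pow_apply, Pi.mul_apply, corrected, remainder]
  generalize ((s⁻¹ : ℝ) : ℂ) = i at *
  generalize (2 * ζ + ζb)⁻¹ = w at *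
  have h5 : (ζ - 2 * α) * w = 1 := by linear_combination h4 - w * h2
  generalize x s = x at *
  generalize E s = E at *
  generalize Eb s = Eb at *
  generalize M s = M at *
  generalize Mb s = Mb at *
  push_cast
  linear_combination (c * x * E - c ^ 2 * ζb * (E ^ 2 * Mb) * i + 2 * c * ζb * (x * E) * i ^ 2) *
      (s * i * h1 + h3) + c ^ 3 * ζb ^ 2 * (x * (E * Eb) * E) * i ^ 2 * (s * i * h5 + h3)

end IsRotated

/-- With `w = √(1 + u)` the left side is `(w - 1)²/2` and the right side `(w - 1)²(w + 1)²/8`, so `w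
≥ 1` suffices. -/
lemma abs_sqrt_one_add_sub_le {u : ℝ} (hu : 0 ≤ u) :
    |Real.sqrt (1 + u) - 1 - u / 2| ≤ u ^ 2 / 8 := by
  have h1 : Real.sqrt (1 + u) ^ 2 = 1 + u := Real.sq_sqrt (by linarith)
  have h2 : 1 ≤ Real.sqrt (1 + u) := Real.one_le_sqrt.2 (by linarith)
  obtain ⟨w, hw⟩ : ∃ w, w = Real.sqrt (1 + u) := ⟨_, rfl⟩
  rw [← hw] at h1 h2 ⊢
  obtain rfl : u = w ^ 2 - 1 := by linarith
  rw [abs_le]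
  constructor
  · nlinarith [mul_nonneg (sq_nonneg (w - 1)) (show 0 ≤ (w + 1) ^ 2 - 4 by nlinarith)]
  · nlinarith [sq_nonneg (w - 1), sq_nonneg (w ^ 2 - 1)]

/-- Uniform control of the real part of the resonant coefficient. For `v = αs²/2` the claim is `2v ≤
e^v`, which follows from `1 + v + v²/2 ≤ e^v`. -/
lemma mul_gaussian_sq_le_inv_sq (α : ℝ) {s : ℝ} (hα : 0 ≤ α) (hs : 0 < s) :
    α * (Real.exp (-α * s ^ 2 / 4) * Real.exp (-α * s ^ 2 / 4)) ≤ s⁻¹ ^ 2 := by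
  rw [← Real.exp_add, show -α * s ^ 2 / 4 + -α * s ^ 2 / 4 = -(α * s ^ 2 / 2) by ring, Real.exp_neg,
    inv_pow, ← div_eq_mul_inv, div_le_iff₀ (Real.exp_pos _), inv_mul_eq_div,
    le_div_iff₀ (by positivity)]
  have := Real.quadratic_le_exp_of_nonneg (show 0 ≤ α * s ^ 2 / 2 by positivity)
  nlinarith [sq_nonneg (α * s ^ 2 / 2 - 1)]

namespace IsRotated

variable {c α : ℝ} {ζ ζb : ℂ} {x E Eb M Mb : ℝ → ℂ}

lemma norm_E_le (h : IsRotated c α ζ ζb x E Eb M Mb) (hα : 0 ≤ α) (s : ℝ) : ‖E s‖ ≤ 1 :=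
  (h.norm_E s).trans_le (gaussian_le_one hα s)

lemma norm_Eb_le (h : IsRotated c α ζ ζb x E Eb M Mb) (hα : 0 ≤ α) (s : ℝ) : ‖Eb s‖ ≤ 1 :=
  (h.norm_Eb s).trans_le (gaussian_le_one hα s)

lemma norm_corrected_sub_le (h : IsRotated c α ζ ζb x E Eb M Mb) (hc : 0 ≤ c) (hα : 0 ≤ α)
    (hω : 1 ≤ ‖2 * ζ + ζb‖) {s : ℝ} (hs : 1 ≤ s) :
    ‖corrected c ζ ζb x E Eb M Mb s - M s - 2 * c * ζb * (x s * E s) * (s⁻¹ : ℝ)‖ ≤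
      (4 * c + c ^ 2 + 2 * c ^ 3) * s⁻¹ ^ 2 := by
  have hE := h.norm_E_le hα s
  have hEb := h.norm_Eb_le hα s
  have hx := h.norm_x s
  have hMb := h.norm_Mb s
  have hw : ‖(2 * ζ + ζb)⁻¹‖ ≤ 1 := by
    rw [norm_inv]
    exact inv_le_one_of_one_le₀ hω
  have hi : 0 ≤ s⁻¹ := by positivity
  have hi1 : s⁻¹ ≤ 1 := inv_le_one_of_one_le₀ hs
  have e : corrected c ζ ζb x E Eb M Mb s - M s - 2 * c * ζb * (x s * E s) * (s⁻¹ : ℝ) =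
      -(c ^ 2 * ζb ^ 2 * (E s ^ 2 * Mb s) * (s⁻¹ : ℝ) ^ 2)
    + 4 * c * ζb ^ 2 * (x s * E s) * (s⁻¹ : ℝ) ^ 3
    + 2 * c ^ 3 * ζb ^ 2 * (2 * ζ + ζb)⁻¹ * (x s * (E s * Eb s) * E s) * (s⁻¹ : ℝ) ^ 3 := by
    rw [corrected]
    ring
  rw [e]
  refine (norm_add₃_le ..).trans ?_
  simp only [norm_neg, norm_mul, norm_pow, Complex.norm_real, Real.norm_of_nonneg hc,
    Real.norm_of_nonneg hi, h.norm_ζb, Complex.norm_ofNat]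
  have h3 : s⁻¹ ^ 3 ≤ s⁻¹ ^ 2 * 1 := by
    rw [pow_succ]
    gcongr
  calc _ ≤ c ^ 2 * 1 ^ 2 * (1 ^ 2 * 1) * s⁻¹ ^ 2 + 4 * c * 1 ^ 2 * (1 * 1) * (s⁻¹ ^ 2 * 1)
        + 2 * c ^ 3 * 1 ^ 2 * 1 * (1 * (1 * 1) * 1) * (s⁻¹ ^ 2 * 1) := by gcongr
    _ = _ := by ring

lemma norm_corrected_le (h : IsRotated c α ζ ζb x E Eb M Mb) (hc : 0 ≤ c) (hα : 0 ≤ α)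
    (hω : 1 ≤ ‖2 * ζ + ζb‖) {s : ℝ} (hs : 1 ≤ s) :
    ‖corrected c ζ ζb x E Eb M Mb s‖ ≤ 1 + 6 * c + c ^ 2 + 2 * c ^ 3 := by
  have h1 := h.norm_corrected_sub_le hc hα hω hs
  have hE := h.norm_E_le hα s
  have hx := h.norm_x s
  have hM := h.norm_M s
  have hi : 0 ≤ s⁻¹ := by positivity
  have hi1 : s⁻¹ ≤ 1 := inv_le_one_of_one_le₀ hs
  have h2 : ‖2 * c * ζb * (x s * E s) * (s⁻¹ : ℝ)‖ ≤ 2 * c * 1 * (1 * 1) * 1 := by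
    simp only [norm_mul, Complex.norm_real, Real.norm_of_nonneg hc, Real.norm_of_nonneg hi,
      h.norm_ζb, Complex.norm_ofNat]
    gcongr
  have h3 : (4 * c + c ^ 2 + 2 * c ^ 3) * s⁻¹ ^ 2 ≤ (4 * c + c ^ 2 + 2 * c ^ 3) * 1 ^ 2 := by
    gcongr
  have h4 := norm_add₃_le (a := corrected c ζ ζb x E Eb M Mb s - M s
    - 2 * c * ζb * (x s * E s) * (s⁻¹ : ℝ)) (b := M s) (c := 2 * c * ζb * (x s * E s) * (s⁻¹ : ℝ))
  rw [show corrected c ζ ζb x E Eb M Mb s - M s - 2 * c * ζb * (x s * E s) * (s⁻¹ : ℝ) + M s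
    + 2 * c * ζb * (x s * E s) * (s⁻¹ : ℝ) = corrected c ζ ζb x E Eb M Mb s by ring] at h4
  linarith

lemma norm_remainder_le (h : IsRotated c α ζ ζb x E Eb M Mb) (hc : 0 ≤ c) (hα : 0 ≤ α)
    (hω : 1 ≤ ‖2 * ζ + ζb‖) {s : ℝ} (hs : 1 ≤ s) :
    ‖remainder c ζ ζb x E Eb M Mb s‖ ≤ 2 * c ^ 2 + 4 * c * (c + 3) + 2 * c ^ 3 * (c + 3)
      + c ^ 2 * (c ^ 2 + 4 * c + 2 * c ^ 3) := by
  have hE := h.norm_E_le hα s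
  have hEb := h.norm_Eb_le hα s
  have hx := h.norm_x s
  have hM := h.norm_M s
  have hMb := h.norm_Mb s
  have hw : ‖(2 * ζ + ζb)⁻¹‖ ≤ 1 := by
    rw [norm_inv]
    exact inv_le_one_of_one_le₀ hω
  have hi : 0 ≤ s⁻¹ := by positivity
  have hi1 : s⁻¹ ≤ 1 := inv_le_one_of_one_le₀ hs
  have hdx : ‖c / 2 * (Eb s * M s + E s * Mb s)‖ ≤ c := by
    have h1 : ‖Eb s * M s + E s * Mb s‖ ≤ 1 * 1 + 1 * 1 :=
      (norm_add_le _ _).trans (by rw [norm_mul, norm_mul]; gcongr)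
    rw [norm_mul, norm_div, Complex.norm_real, Real.norm_of_nonneg hc, Complex.norm_ofNat]
    calc _ ≤ c / 2 * (1 * 1 + 1 * 1) := by gcongr
      _ = c := by ring
  rw [remainder]
  generalize c / 2 * (Eb s * M s + E s * Mb s) = dx at *
  have h1 : ‖dx * E s - 3 * (x s * E s) * (s⁻¹ : ℝ)‖ ≤ c * 1 + 3 * (1 * 1) * 1 := by
    refine (norm_sub_le _ _).trans ?_
    simp only [norm_mul, Complex.norm_real, Real.norm_of_nonneg hi, Complex.norm_ofNat]
    gcongr
  have h2 : ‖dx * (E s * Eb s) * E s - 3 * (x s * (E s * Eb s) * E s) * (s⁻¹ : ℝ)‖ ≤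
      c * (1 * 1) * 1 + 3 * (1 * (1 * 1) * 1) * 1 := by
    refine (norm_sub_le _ _).trans ?_
    simp only [norm_mul, Complex.norm_real, Real.norm_of_nonneg hi, Complex.norm_ofNat]
    gcongr
  have h3 : ‖-(c ^ 2 * ζb ^ 2 * (E s ^ 2 * Mb s)) + 4 * c * ζb ^ 2 * (x s * E s) * (s⁻¹ : ℝ)
        + 2 * c ^ 3 * ζb ^ 2 * (2 * ζ + ζb)⁻¹ * (x s * (E s * Eb s) * E s) * (s⁻¹ : ℝ)‖ ≤
      c ^ 2 * 1 ^ 2 * (1 ^ 2 * 1) + 4 * c * 1 ^ 2 * (1 * 1) * 1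
        + 2 * c ^ 3 * 1 ^ 2 * 1 * (1 * (1 * 1) * 1) * 1 := by
    refine (norm_add₃_le ..).trans ?_
    simp only [norm_neg, norm_mul, norm_pow, Complex.norm_real, Real.norm_of_nonneg hi,
      Real.norm_of_nonneg hc, h.norm_ζb, Complex.norm_ofNat]
    gcongr
  refine (norm_sub_le _ _).trans ((add_le_add_left (norm_add₃_le ..) _).trans ?_)
  simp only [norm_mul, norm_pow, Complex.norm_real, Real.norm_of_nonneg hc, h.norm_ζb,
    Complex.norm_ofNat] at h1 h2 h3 ⊢
  calc _ ≤ 2 * c ^ 2 * 1 ^ 2 * (1 ^ 2 * 1) + 4 * c * 1 ^ 2 * (c * 1 + 3 * (1 * 1) * 1)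
        + 2 * c ^ 3 * 1 ^ 2 * 1 * (c * (1 * 1) * 1 + 3 * (1 * (1 * 1) * 1) * 1)
        + c ^ 2 * 1 * (1 * 1) * (c ^ 2 * 1 ^ 2 * (1 ^ 2 * 1) + 4 * c * 1 ^ 2 * (1 * 1) * 1
        + 2 * c ^ 3 * 1 ^ 2 * 1 * (1 * (1 * 1) * 1) * 1) := by gcongr
    _ = _ := by ring

/-- The phase-compensated normal component converges at a quadratic rate. -/
lemma exists_amplitude (h : IsRotated c α ζ ζb x E Eb M Mb) (hc : 0 ≤ c) (hα : 0 ≤ α) {β : ℝ}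
    (hβ : β ∈ Set.Icc (0 : ℝ) 1) (hζb : ζb = -α - β * Complex.I)
    (hω : 1 ≤ ‖2 * ζ + ζb‖) (hEb : ∀ s, Eb s = starRingEnd ℂ (E s)) {θ : ℝ → ℝ}
    (hθ : ∀ s, 1 ≤ s → HasDerivAt θ (β * (s / 2) * (Real.sqrt (1 + 4 * c ^ 2 *
      (Real.exp (-α * s ^ 2 / 4) * Real.exp (-α * s ^ 2 / 4)) * s⁻¹ ^ 2) - 1)) s) :
    ∃ W : ℂ, Tendsto (fun s => Complex.exp (θ s * Complex.I) * corrected c ζ ζb x E Eb M Mb s)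
        atTop (𝓝 W) ∧
      ∀ s, 1 ≤ s → ‖Complex.exp (θ s * Complex.I) * corrected c ζ ζb x E Eb M Mb s - W‖ ≤
        ((c ^ 4 + c ^ 2) * (1 + 6 * c + c ^ 2 + 2 * c ^ 3) + (2 * c ^ 2 + 4 * c * (c + 3)
          + 2 * c ^ 3 * (c + 3) + c ^ 2 * (c ^ 2 + 4 * c + 2 * c ^ 3))) * s⁻¹ ^ 2 := by
  -- The comparison function is used with `α = 0`: an algebraic rate is enough, because this error
  -- later enters multiplied by `E / s`.
  have key := exists_tendsto_of_deriv_bound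
    (f := fun s => Complex.exp (θ s * Complex.I) * corrected c ζ ζb x E Eb M Mb s)
    (g := fun s => ((c ^ 4 + c ^ 2) * (1 + 6 * c + c ^ 2 + 2 * c ^ 3) + (2 * c ^ 2 + 4 * c * (c + 3)
          + 2 * c ^ 3 * (c + 3) + c ^ 2 * (c ^ 2 + 4 * c + 2 * c ^ 3))) *
          (Real.exp (-0 * s ^ 2 / 4) * s⁻¹ ^ (1 + 1))) (fun s hs => ?_)
    (fun s hs => hasDerivAt_gaussian_mul_inv_pow 0 _ 1 (by positivity))
    (tendsto_gaussian_mul_inv_pow le_rfl _ _)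
  · simpa using key
  · have hs0 : s ≠ 0 := by positivity
    have hω0 : 2 * ζ + ζb ≠ 0 := norm_pos_iff.1 (by linarith)
    have hQ := h.norm_corrected_le hc hα hω hs
    have hR := h.norm_remainder_le hc hα hω hs
    have hdQ := h.hasDerivAt_corrected hω0 hs0
    have hD : E s * Eb s =
        ((Real.exp (-α * s ^ 2 / 4) * Real.exp (-α * s ^ 2 / 4) : ℝ) : ℂ) := by
      rw [hEb, Complex.mul_conj, ← Complex.sq_norm, h.norm_E, sq]
    have hdx := (hθ s hs)
    have hsm := mul_gaussian_sq_le_inv_sq α hα (by positivity : 0 < s)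
    have hd1 : Real.exp (-α * s ^ 2 / 4) * Real.exp (-α * s ^ 2 / 4) ≤ 1 :=
      mul_le_one₀ (gaussian_le_one hα s) (Real.exp_nonneg _) (gaussian_le_one hα s)
    have hd0 : 0 ≤ Real.exp (-α * s ^ 2 / 4) * Real.exp (-α * s ^ 2 / 4) := by positivity
    have hi : 0 ≤ s⁻¹ := by positivity
    have hsi : s * s⁻¹ = 1 := mul_inv_cancel₀ hs0
    rw [hD] at hdQ
    generalize Real.exp (-α * s ^ 2 / 4) * Real.exp (-α * s ^ 2 / 4) = d at *
    have hsq := abs_sqrt_one_add_sub_le (show 0 ≤ 4 * c ^ 2 * d * s⁻¹ ^ 2 by positivity)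
    generalize Real.sqrt (1 + 4 * c ^ 2 * d * s⁻¹ ^ 2) = w at *
    -- The phase speed agrees with the drift `β c² |E|² / s` up to `O(s⁻³)`.
    have hphase : |β * (s / 2) * (w - 1) - β * c ^ 2 * d * s⁻¹| ≤ c ^ 4 * s⁻¹ ^ 3 := by
      have e : β * (s / 2) * (w - 1) - β * c ^ 2 * d * s⁻¹ =
          β * (s / 2) * (w - 1 - 4 * c ^ 2 * d * s⁻¹ ^ 2 / 2) := by
        linear_combination (β * c ^ 2 * d * s⁻¹) * hsi
      have hβ0 := hβ.1
      have hβ1 := hβ.2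
      rw [e, abs_mul, abs_of_nonneg (by positivity : 0 ≤ β * (s / 2))]
      calc _ ≤ 1 * (s / 2) * ((4 * c ^ 2 * d * s⁻¹ ^ 2) ^ 2 / 8) := by gcongr
        _ = c ^ 4 * d ^ 2 * s⁻¹ ^ 3 := by
          linear_combination (c ^ 4 * d ^ 2 * s⁻¹ ^ 3) * hsi
        _ ≤ c ^ 4 * 1 ^ 2 * s⁻¹ ^ 3 := by gcongr
        _ = _ := by ring
    refine ⟨_, ((hdx.ofReal_comp.mul_const Complex.I).cexp).mul hdQ, ?_⟩
    generalize corrected c ζ ζb x E Eb M Mb s = Q at *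
    generalize remainder c ζ ζb x E Eb M Mb s = R at *
    -- With `ζ̄ = -α - iβ`, the imaginary drift is compensated by `θ'`, and the real part `-c² α
    -- |E|² / s` is `O(s⁻³)` by `hsm`.
    have e : Complex.exp (θ s * Complex.I) *
          (((β * (s / 2) * (w - 1) : ℝ) : ℂ) * Complex.I) * Q +
        Complex.exp (θ s * Complex.I) * (c ^ 2 * ζb * d * (s⁻¹ : ℝ) * Q + R * (s⁻¹ : ℝ) ^ 3) =
        Complex.exp (θ s * Complex.I) * ((((β * (s / 2) * (w - 1) - β * c ^ 2 * d * s⁻¹ : ℝ) : ℂ)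
          * Complex.I - ((c ^ 2 * (α * d) * s⁻¹ : ℝ) : ℂ)) * Q + R * ((s⁻¹ ^ 3 : ℝ) : ℂ)) := by
      rw [hζb]
      push_cast
      ring
    have h1 : ‖((β * (s / 2) * (w - 1) - β * c ^ 2 * d * s⁻¹ : ℝ) : ℂ)
          * Complex.I - ((c ^ 2 * (α * d) * s⁻¹ : ℝ) : ℂ)‖ ≤ c ^ 4 * s⁻¹ ^ 3
            + c ^ 2 * s⁻¹ ^ 2 * s⁻¹ := by
      refine (norm_sub_le _ _).trans ?_
      rw [norm_mul, Complex.norm_I, mul_one, Complex.norm_real, Complex.norm_real,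
        Real.norm_eq_abs, Real.norm_of_nonneg (by positivity)]
      gcongr
    have h2 : ‖((s⁻¹ ^ 3 : ℝ) : ℂ)‖ = s⁻¹ ^ 3 := by
      rw [Complex.norm_real, Real.norm_of_nonneg (by positivity)]
    rw [e, norm_mul, Complex.norm_exp_ofReal_mul_I, one_mul]
    refine (norm_add_le _ _).trans ?_
    rw [norm_mul, norm_mul, h2]
    calc _ ≤ (c ^ 4 * s⁻¹ ^ 3 + c ^ 2 * s⁻¹ ^ 2 * s⁻¹) * (1 + 6 * c + c ^ 2 + 2 * c ^ 3)
        + (2 * c ^ 2 + 4 * c * (c + 3) + 2 * c ^ 3 * (c + 3)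
          + c ^ 2 * (c ^ 2 + 4 * c + 2 * c ^ 3)) * s⁻¹ ^ 3 := by gcongr
      _ = ((c ^ 4 + c ^ 2) * (1 + 6 * c + c ^ 2 + 2 * c ^ 3) + (2 * c ^ 2 + 4 * c * (c + 3)
          + 2 * c ^ 3 * (c + 3) + c ^ 2 * (c ^ 2 + 4 * c + 2 * c ^ 3))) * s⁻¹ ^ 3 := by ring
      _ ≤ _ := by
        simp only [neg_zero, zero_mul, zero_div, Real.exp_zero, Nat.cast_one, mul_one, zero_add]
        refine mul_le_mul_of_nonneg_left ?_ (by positivity)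
        have : 0 ≤ s⁻¹ ^ 3 := by positivity
        linarith

end IsRotated

/-! ### Combining both asymptotics into the expansion. -/

/-- The rate constant of the convergence of the tangent component. -/
noncomputable def tangentRate (c : ℝ) : ℝ := 4 * c + 4 * c ^ 2

/-- The rate constant of the convergence of the phase-compensated normal component. -/
noncomputable def amplitudeRate (c : ℝ) : ℝ :=
  (c ^ 4 + c ^ 2) * (1 + 6 * c + c ^ 2 + 2 * c ^ 3) + (2 * c ^ 2 + 4 * c * (c + 3)
    + 2 * c ^ 3 * (c + 3) + c ^ 2 * (c ^ 2 + 4 * c + 2 * c ^ 3))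

/-- The constant in the error bound of the expansion. -/
noncomputable def errorRate (c : ℝ) : ℝ :=
  (12 * c + 16 * c ^ 2 + 8 * c ^ 2 * tangentRate c) + 4 * c
    + 2 * c * (amplitudeRate c + (4 * c + c ^ 2 + 2 * c ^ 3)) + 4 * c ^ 2 * tangentRate c

lemma tangentRate_nonneg {c : ℝ} (hc : 0 ≤ c) : 0 ≤ tangentRate c := by
  unfold tangentRate; positivity

lemma amplitudeRate_nonneg {c : ℝ} (hc : 0 ≤ c) : 0 ≤ amplitudeRate c := by
  unfold amplitudeRate; positivity

lemma errorRate_nonneg {c : ℝ} (hc : 0 ≤ c) : 0 ≤ errorRate c := by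
  have := tangentRate_nonneg hc
  have := amplitudeRate_nonneg hc
  unfold errorRate; positivity

/-- Insert `M ≈ e^{-iθ} W - 2c ζ̄ x E / s` into the first-order term of the tangent expansion. The
first part gives the oscillation; the second gives `-4c² x |E|² / s²`, which together with the `+2c²
A |E|² / s²` from the second stage leaves the coefficient `-2c²`. -/
lemma IsRotated.exists_expansion {c α : ℝ} {ζ ζb : ℂ} {E Eb M Mb : ℝ → ℂ} {x : ℝ → ℝ}
    (h : IsRotated c α ζ ζb (fun s => x s) E Eb M Mb) (hc : 0 ≤ c)
    (hα : α ∈ Set.Icc (0 : ℝ) 1) {β : ℝ} (hβ : β ∈ Set.Icc (0 : ℝ) 1)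
    (hζb : ζb = -α - β * Complex.I) (hζ : ζb = starRingEnd ℂ ζ)
    (hEb : ∀ s, Eb s = starRingEnd ℂ (E s)) (hMb : ∀ s, Mb s = starRingEnd ℂ (M s))
    (hxM : ∀ s, x s ^ 2 + ‖M s‖ ^ 2 = 1) {θ : ℝ → ℝ}
    (hθ : ∀ s, 1 ≤ s → HasDerivAt θ (β * (s / 2) * (Real.sqrt (1 + 4 * c ^ 2 *
      (Real.exp (-α * s ^ 2 / 4) * Real.exp (-α * s ^ 2 / 4)) * s⁻¹ ^ 2) - 1)) s) :
    ∃ (A : ℝ) (W : ℂ), A ^ 2 + ‖W‖ ^ 2 = 1 ∧ Tendsto x atTop (𝓝 A) ∧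
      (∀ s, 1 ≤ s → |x s - A| ≤ tangentRate c * (Real.exp (-α * s ^ 2 / 4) * s⁻¹)) ∧
      ∀ s, 1 ≤ s → |x s - (A + 2 * c * s⁻¹ *
          (ζ * (Eb s * (Complex.exp (-(θ s * Complex.I)) * W))).re
          - 2 * c ^ 2 * A * (Real.exp (-α * s ^ 2 / 4) * Real.exp (-α * s ^ 2 / 4)) * s⁻¹ ^ 2)| ≤
        errorRate c * (Real.exp (-α * s ^ 2 / 4) * s⁻¹ ^ 3) := by
  have hω := h.one_le_norm_omega hζ
  obtain ⟨A', hA', hA1', hxA'⟩ := h.exists_limit hc hα.1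
  obtain ⟨W, hW, hQW⟩ := h.exists_amplitude hc hα.1 hβ hζb hω hEb hθ
  have hA : Tendsto x atTop (𝓝 A'.re) :=
    ((Complex.continuous_re.tendsto A').comp hA').congr fun s => Complex.ofReal_re _
  obtain ⟨A, rfl⟩ : ∃ A : ℝ, A' = A :=
    ⟨A'.re, tendsto_nhds_unique hA' ((Complex.continuous_ofReal.tendsto _).comp hA)⟩
  rw [Complex.ofReal_re] at hA
  have hxA : ∀ s, 1 ≤ s → |x s - A| ≤ tangentRate c * (Real.exp (-α * s ^ 2 / 4) * s⁻¹) := by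
    intro s hs
    have := hxA' s hs
    rwa [← Complex.ofReal_sub, Complex.norm_real, Real.norm_eq_abs] at this
  have hA1 : ‖(A : ℂ)‖ ≤ 1 := le_of_tendsto hA'.norm (Eventually.of_forall h.norm_x)
  have hi0 : Tendsto (fun s : ℝ => s⁻¹) atTop (𝓝 0) := tendsto_inv_atTop_zero
  -- The corrections vanish at infinity and `e^{iθ}` is unimodular, so `|M|` tends to `|W|`.
  have hAW : A ^ 2 + ‖W‖ ^ 2 = 1 := by
    have h1 : Tendsto (fun s => ‖corrected c ζ ζb (fun s => x s) E Eb M Mb s‖) atTop (𝓝 ‖W‖) := by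
      simpa using hW.norm
    have h2 : Tendsto (fun s => ‖corrected c ζ ζb (fun s => x s) E Eb M Mb s‖ - ‖M s‖)
        atTop (𝓝 0) := by
      refine squeeze_zero_norm' (a := fun s => (6 * c + c ^ 2 + 2 * c ^ 3) * s⁻¹) ?_
        (by simpa using hi0.const_mul (6 * c + c ^ 2 + 2 * c ^ 3))
      filter_upwards [eventually_ge_atTop 1] with s hs
      have hi : 0 ≤ s⁻¹ := by positivity
      have hi1 : s⁻¹ ≤ 1 := inv_le_one_of_one_le₀ hs
      have hE := h.norm_E_le hα.1 s
      have hx := h.norm_x s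
      have h3 := h.norm_corrected_sub_le hc hα.1 hω hs
      have h4 : ‖2 * c * ζb * (x s * E s) * (s⁻¹ : ℝ)‖ ≤ 2 * c * 1 * (1 * 1) * s⁻¹ := by
        simp only [norm_mul, Complex.norm_real ↑c, Complex.norm_real (s⁻¹), Real.norm_of_nonneg hc,
          Real.norm_of_nonneg hi, h.norm_ζb, Complex.norm_ofNat]
        gcongr
      have h5 : (4 * c + c ^ 2 + 2 * c ^ 3) * s⁻¹ ^ 2 ≤
          (4 * c + c ^ 2 + 2 * c ^ 3) * (s⁻¹ * 1) := by
        rw [sq s⁻¹]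
        gcongr
      refine (abs_norm_sub_norm_le _ _).trans ?_
      have h6 := norm_add_le (corrected c ζ ζb (fun s => x s) E Eb M Mb s - M s
        - 2 * c * ζb * (x s * E s) * (s⁻¹ : ℝ)) (2 * c * ζb * (x s * E s) * (s⁻¹ : ℝ))
      rw [sub_add_cancel] at h6
      linarith
    have h3 : Tendsto (fun s => ‖M s‖) atTop (𝓝 ‖W‖) := by simpa using h1.sub h2
    refine tendsto_nhds_unique ((hA.pow 2).add (h3.pow 2)) ?_
    simp only [hxM]
    exact tendsto_const_nhds
  refine ⟨A, W, hAW, hA, hxA, fun s hs => ?_⟩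
  have hs0 : s ≠ 0 := by positivity
  have hi : 0 ≤ s⁻¹ := by positivity
  have h2 := h.norm_stage_two_le hc hα hA1' (tangentRate_nonneg hc) hxA' hA1 hs
  have hosc2 := h.norm_osc (s := s) (h.norm_M s) (h.norm_Mb s) 2
  have hD : E s * Eb s =
      ((Real.exp (-α * s ^ 2 / 4) * Real.exp (-α * s ^ 2 / 4) : ℝ) : ℂ) := by
    rw [hEb, Complex.mul_conj, ← Complex.sq_norm, h.norm_E, sq]
  obtain ⟨V, hV⟩ : ∃ V, V = Complex.exp (-(θ s * Complex.I)) * W := ⟨_, rfl⟩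
  -- `ρ` is the error of the first-order approximation of `M`, of size `s⁻²`.
  obtain ⟨ρ, hρ⟩ : ∃ ρ, ρ = M s - (V - 2 * c * ζb * (x s * E s) * (s⁻¹ : ℝ)) := ⟨_, rfl⟩
  have hρb : starRingEnd ℂ ρ =
      Mb s - (starRingEnd ℂ V - 2 * c * ζ * (x s * Eb s) * (s⁻¹ : ℝ)) := by
    rw [hρ, hMb, hEb, hζ]
    simp [show starRingEnd ℂ 2 = 2 from map_ofNat _ 2]
  have hρn : ‖ρ‖ ≤ (amplitudeRate c + (4 * c + c ^ 2 + 2 * c ^ 3)) * s⁻¹ ^ 2 := by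
    have h3 := h.norm_corrected_sub_le hc hα.1 hω hs
    have h4 := hQW s hs
    have e4 : Complex.exp (θ s * Complex.I) * corrected c ζ ζb (fun s => x s) E Eb M Mb s - W =
        Complex.exp (θ s * Complex.I) * (corrected c ζ ζb (fun s => x s) E Eb M Mb s - V) := by
      rw [hV, mul_sub, ← mul_assoc, ← Complex.exp_add, add_neg_cancel, Complex.exp_zero, one_mul]
    rw [e4, norm_mul, Complex.norm_exp_ofReal_mul_I, one_mul] at h4
    have e : ρ = (corrected c ζ ζb (fun s => x s) E Eb M Mb s - V) -
        (corrected c ζ ζb (fun s => x s) E Eb M Mb s - M s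
          - 2 * c * ζb * (x s * E s) * (s⁻¹ : ℝ)) := by rw [hρ]; ring
    rw [e]
    refine (norm_sub_le _ _).trans ?_
    rw [add_mul]
    exact add_le_add h4 h3
  have hosc1 := h.norm_osc (s := s) hρn ((RCLike.norm_conj ρ).trans_le hρn) 1
  have hre : ((2 * c * s⁻¹ * (ζ * (Eb s * V)).re : ℝ) : ℂ) =
      c * (ζ * (Eb s * V) + ζb * (E s * starRingEnd ℂ V)) * (s⁻¹ : ℝ) := by
    have : ζb * (E s * starRingEnd ℂ V) = starRingEnd ℂ (ζ * (Eb s * V)) := by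
      rw [hζ, hEb]
      simp
    rw [this, Complex.add_conj]
    push_cast
    ring
  rw [← hV, ← Real.norm_eq_abs, ← Complex.norm_real]
  have key : ((x s - (A + 2 * c * s⁻¹ * (ζ * (Eb s * V)).re - 2 * c ^ 2 * A *
      (Real.exp (-α * s ^ 2 / 4) * Real.exp (-α * s ^ 2 / 4)) * s⁻¹ ^ 2) : ℝ) : ℂ) =
      ((x s - c * (ζ ^ 1 * (Eb s * M s) + ζb ^ 1 * (E s * Mb s)) * (s⁻¹ : ℝ))
        - 2 * c * (ζ ^ 2 * (Eb s * M s) + ζb ^ 2 * (E s * Mb s)) * (s⁻¹ : ℝ) ^ 3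
        - 2 * c ^ 2 * A * (E s * Eb s) * (s⁻¹ : ℝ) ^ 2 - A)
      + 2 * c * (ζ ^ 2 * (Eb s * M s) + ζb ^ 2 * (E s * Mb s)) * (s⁻¹ : ℝ) ^ 3
      + c * (ζ ^ 1 * (Eb s * ρ) + ζb ^ 1 * (E s * starRingEnd ℂ ρ)) * (s⁻¹ : ℝ)
      - 4 * c ^ 2 * (x s - A : ℂ) * (E s * Eb s) * (s⁻¹ : ℝ) ^ 2 := by
    rw [Complex.ofReal_sub, Complex.ofReal_sub, Complex.ofReal_add, hre, hρb, hρ,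
      Complex.ofReal_mul (_ * _), Complex.ofReal_mul (_ * _), ← hD]
    push_cast
    linear_combination (-(4 * c ^ 2 * x s * (E s * Eb s) * (s : ℂ)⁻¹ ^ 2)) * h.mul_eq
  rw [key]
  refine (norm_sub_le _ _).trans ((add_le_add_left (norm_add₃_le ..) _).trans ?_)
  have h5 : ‖2 * c * (ζ ^ 2 * (Eb s * M s) + ζb ^ 2 * (E s * Mb s)) * (s⁻¹ : ℝ) ^ 3‖ ≤
      2 * c * (2 * 1 * Real.exp (-α * s ^ 2 / 4)) * s⁻¹ ^ 3 := by
    simp only [norm_mul, norm_pow, Complex.norm_real, Real.norm_of_nonneg hc,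
      Real.norm_of_nonneg hi, Complex.norm_ofNat]
    gcongr
  have h6 : ‖c * (ζ ^ 1 * (Eb s * ρ) + ζb ^ 1 * (E s * starRingEnd ℂ ρ)) * (s⁻¹ : ℝ)‖ ≤
      c * (2 * ((amplitudeRate c + (4 * c + c ^ 2 + 2 * c ^ 3)) * s⁻¹ ^ 2) *
        Real.exp (-α * s ^ 2 / 4)) * s⁻¹ := by
    rw [norm_mul, norm_mul, Complex.norm_real, Complex.norm_real, Real.norm_of_nonneg hc,
      Real.norm_of_nonneg hi]
    gcongr
  have h7 : ‖4 * c ^ 2 * (x s - A : ℂ) * (E s * Eb s) * (s⁻¹ : ℝ) ^ 2‖ ≤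
      4 * c ^ 2 * (tangentRate c * (Real.exp (-α * s ^ 2 / 4) * s⁻¹)) * (1 * 1) * s⁻¹ ^ 2 := by
    have := hxA' s hs
    have h8 := h.norm_E_le hα.1 s
    have h9 := h.norm_Eb_le hα.1 s
    rw [norm_mul, norm_mul, norm_mul, norm_mul, norm_mul, norm_pow, norm_pow, Complex.norm_real,
      Complex.norm_real, Real.norm_of_nonneg hc, Real.norm_of_nonneg hi, Complex.norm_ofNat]
    unfold tangentRate
    gcongr
  unfold errorRate
  refine (add_le_add (add_le_add_three h2 h5 h6) h7).trans (le_of_eq ?_)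
  ring

/-! ### From the scalar Serret-Frenet system to the rotated one; phase and angle. -/

lemma beta_mem_Icc (α : ℝ) : beta α ∈ Set.Icc (0 : ℝ) 1 :=
  ⟨Real.sqrt_nonneg _, Real.sqrt_le_one.2 (by nlinarith [sq_nonneg α])⟩

lemma sq_add_beta_sq {α : ℝ} (hα : α ∈ Set.Icc (0 : ℝ) 1) : α ^ 2 + beta α ^ 2 = 1 := by
  rw [beta, Real.sq_sqrt (by nlinarith [hα.1, hα.2])]
  ring

lemma continuous_curvature (c α : ℝ) : Continuous (curvature c α) := by
  unfold curvature; fun_prop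

lemma continuous_torsion (α : ℝ) : Continuous (torsion α) := by
  unfold torsion; fun_prop

/-- The oscillating factor `exp (i β s² / 4)`. -/
noncomputable def rotor (β s : ℝ) : ℂ := Complex.exp ((β * s ^ 2 / 4 : ℝ) * Complex.I)

lemma rotor_mul_rotor_neg (β s : ℝ) : rotor β s * rotor (-β) s = 1 := by
  rw [rotor, rotor, ← Complex.exp_add, ← Complex.exp_zero]
  congr 1
  push_cast
  ring

lemma norm_rotor (β s : ℝ) : ‖rotor β s‖ = 1 := Complex.norm_exp_ofReal_mul_I _

lemma conj_rotor (β s : ℝ) : starRingEnd ℂ (rotor β s) = rotor (-β) s := by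
  rw [rotor, rotor, ← Complex.exp_conj]
  congr 1
  rw [map_mul, Complex.conj_ofReal, Complex.conj_I]
  push_cast
  ring

lemma hasDerivAt_rotor (β s : ℝ) :
    HasDerivAt (rotor β) (β / 2 * s * Complex.I * rotor β s) s := by
  have h : HasDerivAt (fun s : ℝ => β * s ^ 2 / 4) (β / 2 * s) s := by
    refine (((hasDerivAt_pow 2 s).const_mul β).div_const 4).congr_deriv ?_
    push_cast
    ring
  refine ((h.ofReal_comp.mul_const Complex.I).cexp).congr_deriv ?_
  rw [rotor]
  push_cast
  ring

/-- The torsion acts on `y + iz` as the rotation speed `-iβs/2`, which multiplication by `exp(iβ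
s²/4)` cancels exactly. -/
lemma IsFrenetOn.isRotated {c α : ℝ} (hα : α ∈ Set.Icc (0 : ℝ) 1)
    {x y z : ℝ → ℝ} (h : IsFrenetOn (curvature c α) (torsion α) Set.univ x y z)
    (h1 : ∀ s, x s ^ 2 + y s ^ 2 + z s ^ 2 = 1) :
    IsRotated c α (-α + beta α * Complex.I) (-α - beta α * Complex.I) (fun s => x s)
      (fun s => Real.exp (-α * s ^ 2 / 4) * rotor (beta α) s)
      (fun s => Real.exp (-α * s ^ 2 / 4) * rotor (-beta α) s)
      (fun s => (y s + z s * Complex.I) * rotor (beta α) s)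
      (fun s => (y s - z s * Complex.I) * rotor (-beta α) s) := by
  have hβ := sq_add_beta_sq hα
  have hβ' : (α : ℂ) ^ 2 + (beta α : ℂ) ^ 2 = 1 := by exact_mod_cast hβ
  have hexp : ∀ s, ‖Real.exp (-α * s ^ 2 / 4)‖ = Real.exp (-α * s ^ 2 / 4) := fun s =>
    Real.norm_of_nonneg (Real.exp_nonneg _)
  refine ⟨fun s => ?_, fun s => ?_, fun s => ?_, fun s => ?_, fun s => ?_, ?_, ?_, ?_, ?_,
    fun s => ?_, fun s => ?_, fun s => ?_, fun s => ?_, fun s => ?_⟩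
  · refine (h.dx s trivial).ofReal_comp.congr_deriv ?_
    rw [curvature]
    push_cast
    linear_combination (-(c * Complex.exp (-α * s ^ 2 / 4) * y s)) *
      rotor_mul_rotor_neg (beta α) s
  · refine (((h.dy s trivial).ofReal_comp.add
      ((h.dz s trivial).ofReal_comp.mul_const Complex.I)).mul
        (hasDerivAt_rotor (beta α) s)).congr_deriv ?_
    rw [curvature, torsion]
    simp only [Pi.add_apply]
    push_cast
    linear_combination (beta α / 2 * s * z s * rotor (beta α) s) * Complex.I_sq
  · refine (((h.dy s trivial).ofReal_comp.sub
      ((h.dz s trivial).ofReal_comp.mul_const Complex.I)).mul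
        (hasDerivAt_rotor (-beta α) s)).congr_deriv ?_
    rw [curvature, torsion]
    simp only [Pi.sub_apply]
    push_cast
    linear_combination (beta α / 2 * s * z s * rotor (-beta α) s) * Complex.I_sq
  · refine ((hasDerivAt_gaussian α s).ofReal_comp.mul
      (hasDerivAt_rotor (beta α) s)).congr_deriv ?_
    push_cast
    ring
  · refine ((hasDerivAt_gaussian α s).ofReal_comp.mul
      (hasDerivAt_rotor (-beta α) s)).congr_deriv ?_
    push_cast
    ring
  · linear_combination hβ' - (beta α : ℂ) ^ 2 * Complex.I_sq
  · ring
  · rw [← sq_eq_sq₀ (norm_nonneg _) zero_le_one, Complex.sq_norm, Complex.normSq_apply]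
    simp
    linarith
  · rw [← sq_eq_sq₀ (norm_nonneg _) zero_le_one, Complex.sq_norm, Complex.normSq_apply]
    simp
    linarith
  · rw [Complex.norm_real, ← sq_le_sq₀ (norm_nonneg _) zero_le_one, Real.norm_eq_abs, sq_abs]
    nlinarith [h1 s, sq_nonneg (y s), sq_nonneg (z s)]
  · rw [norm_mul, norm_rotor, mul_one, ← sq_le_sq₀ (norm_nonneg _) zero_le_one, Complex.sq_norm,
      Complex.normSq_apply]
    simp
    nlinarith [h1 s, sq_nonneg (x s)]
  · rw [norm_mul, norm_rotor, mul_one, ← sq_le_sq₀ (norm_nonneg _) zero_le_one, Complex.sq_norm,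
      Complex.normSq_apply]
    simp
    nlinarith [h1 s, sq_nonneg (x s)]
  · rw [norm_mul, norm_rotor, mul_one, Complex.norm_real, hexp]
  · rw [norm_mul, norm_rotor, mul_one, Complex.norm_real, hexp]

lemma s0_pos (c : ℝ) : 0 < s0 c := by
  unfold s0; positivity

lemma one_le_s0 (c : ℝ) : 1 ≤ s0 c := by
  have : 1 ≤ Real.sqrt (8 + c ^ 2) := Real.one_le_sqrt.2 (by nlinarith [sq_nonneg c])
  unfold s0
  linarith

lemma phase_eq_add (c α a s : ℝ) : phase c α a s = a + phase c α 0 s := by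
  simp [phase]

lemma hasDerivAt_phase (c α : ℝ) {s : ℝ} (hs : 0 < s) :
    HasDerivAt (phase c α 0) (beta α * (s / 2) * Real.sqrt (1 + 4 * c ^ 2 *
      (Real.exp (-α * s ^ 2 / 4) * Real.exp (-α * s ^ 2 / 4)) * s⁻¹ ^ 2)) s := by
  set g : ℝ → ℝ := fun σ => Real.sqrt (1 + c ^ 2 * (Real.exp (-2 * α * σ) / σ)) with hg
  have hcont : ContinuousOn g (Set.Ioi 0) := by
    intro σ hσ
    have : σ ≠ 0 := ne_of_gt hσ
    refine ContinuousAt.continuousWithinAt ?_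
    fun_prop (disch := assumption)
  have h0 : 0 < s0 c ^ 2 / 4 := by have := s0_pos c; positivity
  have h1 : 0 < s ^ 2 / 4 := by positivity
  have hsub : Set.uIcc (s0 c ^ 2 / 4) (s ^ 2 / 4) ⊆ Set.Ioi 0 := fun σ hσ =>
    lt_of_lt_of_le (lt_min h0 h1) hσ.1
  have hint := (hcont.mono hsub).intervalIntegrable (μ := volume)
  have hmem : Set.Ioi (0 : ℝ) ∈ 𝓝 (s ^ 2 / 4) := Ioi_mem_nhds h1
  have hd := intervalIntegral.integral_hasDerivAt_right hint
    (hcont.stronglyMeasurableAtFilter isOpen_Ioi _ h1) (hcont.continuousAt hmem)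
  have hq : HasDerivAt (fun s : ℝ => s ^ 2 / 4) (s / 2) s := by
    refine ((hasDerivAt_pow 2 s).div_const 4).congr_deriv ?_
    push_cast
    ring
  refine (((hd.comp s hq).const_mul (beta α)).const_add 0).congr_deriv ?_
  have e : Real.exp (-2 * α * (s ^ 2 / 4)) / (s ^ 2 / 4) =
      4 * (Real.exp (-α * s ^ 2 / 4) * Real.exp (-α * s ^ 2 / 4)) * s⁻¹ ^ 2 := by
    rw [← Real.exp_add, show -α * s ^ 2 / 4 + -α * s ^ 2 / 4 = -2 * α * (s ^ 2 / 4) by ring]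
    field_simp
  simp only [hg, e]
  ring_nf

/-- Every complex number is `i ‖W‖ e^{-ia}` for some angle `a ∈ [0, 2π)`. -/
lemma exists_angle (W : ℂ) : ∃ a ∈ Set.Ico (0 : ℝ) (2 * Real.pi),
    W = ‖W‖ * Complex.I * Complex.exp (-(a * Complex.I)) := by
  refine ⟨toIcoMod Real.two_pi_pos 0 (Real.pi / 2 - W.arg), ?_, ?_⟩
  · simpa using toIcoMod_mem_Ico Real.two_pi_pos 0 (Real.pi / 2 - W.arg)
  · rw [toIcoMod]
    set n := toIcoDiv Real.two_pi_pos 0 (Real.pi / 2 - W.arg)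
    have e : -(((Real.pi / 2 - W.arg - n • (2 * Real.pi) : ℝ) : ℂ) * Complex.I) =
        W.arg * Complex.I + (-(Real.pi / 2 * Complex.I)) + n * (2 * Real.pi * Complex.I) := by
      push_cast [zsmul_eq_mul]
      ring
    rw [e, Complex.exp_add, Complex.exp_int_mul_two_pi_mul_I, mul_one, Complex.exp_add,
      Complex.exp_neg, Complex.exp_pi_div_two_mul_I]
    conv_lhs => rw [← Complex.norm_mul_exp_arg_mul_I W]
    field_simp

/-- Expansion at infinity of the tangent component of a scalar solution. -/
lemma IsFrenetOn.exists_expansion {c α : ℝ} (hc : 0 ≤ c) (hα : α ∈ Set.Icc (0 : ℝ) 1)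
    {x y z : ℝ → ℝ} (h : IsFrenetOn (curvature c α) (torsion α) Set.univ x y z)
    (h1 : ∀ s, x s ^ 2 + y s ^ 2 + z s ^ 2 = 1) :
    ∃ (A a : ℝ), a ∈ Set.Ico (0 : ℝ) (2 * Real.pi) ∧ Tendsto x atTop (𝓝 A) ∧
      (∀ s, 1 ≤ s → |x s - A| ≤ tangentRate c * (Real.exp (-α * s ^ 2 / 4) * s⁻¹)) ∧
      ∀ s, 1 ≤ s → |x s - (A - 2 * c / s * Real.sqrt (1 - A ^ 2) * Real.exp (-α * s ^ 2 / 4) *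
          (α * Real.sin (phase c α a s) + beta α * Real.cos (phase c α a s))
          - 2 * c ^ 2 / s ^ 2 * A * Real.exp (-α * s ^ 2 / 2))| ≤
        errorRate c * (Real.exp (-α * s ^ 2 / 4) / s ^ 3) := by
  obtain ⟨A, W, hAW, hA, hxA, hexp⟩ := (h.isRotated hα h1).exists_expansion hc hα (beta_mem_Icc α)
    rfl (by simp [sub_eq_add_neg]) (fun s => by rw [map_mul, Complex.conj_ofReal, conj_rotor])
    (fun s => by rw [map_mul, conj_rotor]; simp [sub_eq_add_neg])
    (fun s => by
      rw [norm_mul, norm_rotor, mul_one, Complex.sq_norm, Complex.normSq_apply]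
      simp
      linarith [h1 s])
    -- Subtracting `β s²/4` leaves only the excess of the square root over `1`; the subtracted part
    -- is restored by the rotor in `Ē`.
    (θ := fun s => phase c α 0 s - beta α * s ^ 2 / 4)
    (fun s hs => by
      refine ((hasDerivAt_phase c α (by linarith)).sub
        (((hasDerivAt_pow 2 s).const_mul (beta α)).div_const 4)).congr_deriv ?_
      push_cast
      ring)
  -- The factor `i` in this normal form turns the real part of `ζ` times the oscillation into `-(α
  -- sin + β cos)`.
  obtain ⟨a, ha, hW⟩ := exists_angle W
  refine ⟨A, a, ha, hA, hxA, fun s hs => ?_⟩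
  have hr : ‖W‖ = Real.sqrt (1 - A ^ 2) := by
    rw [← Real.sqrt_sq (norm_nonneg W)]
    congr 1
    linarith
  have hre : ((-α + beta α * Complex.I) * ((Real.exp (-α * s ^ 2 / 4) * rotor (-beta α) s) *
      (Complex.exp (-(((phase c α 0 s - beta α * s ^ 2 / 4 : ℝ) : ℂ) * Complex.I)) * W))).re =
      -(Real.sqrt (1 - A ^ 2) * Real.exp (-α * s ^ 2 / 4) *
        (α * Real.sin (phase c α a s) + beta α * Real.cos (phase c α a s))) := by
    have e : rotor (-beta α) s *
        (Complex.exp (-(((phase c α 0 s - beta α * s ^ 2 / 4 : ℝ) : ℂ) * Complex.I)) *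
          Complex.exp (-(a * Complex.I))) =
        Complex.exp ((-phase c α a s : ℝ) * Complex.I) := by
      rw [rotor, ← Complex.exp_add, ← Complex.exp_add, phase_eq_add c α a]
      congr 1
      push_cast
      ring
    have e2 : (-α + beta α * Complex.I) * ((Real.exp (-α * s ^ 2 / 4) * rotor (-beta α) s) *
        (Complex.exp (-(((phase c α 0 s - beta α * s ^ 2 / 4 : ℝ) : ℂ) * Complex.I)) * W)) =
        ((Real.exp (-α * s ^ 2 / 4) * Real.sqrt (1 - A ^ 2) : ℝ) : ℂ) *
          ((-α + beta α * Complex.I) * Complex.I *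
            Complex.exp ((-phase c α a s : ℝ) * Complex.I)) := by
      rw [← e, hW, hr]
      push_cast
      ring
    rw [e2, Complex.re_ofReal_mul, Complex.exp_mul_I, ← Complex.ofReal_cos, ← Complex.ofReal_sin,
      Real.cos_neg, Real.sin_neg]
    generalize Real.cos (phase c α a s) = C
    generalize Real.sin (phase c α a s) = S
    simp
    ring
  have h2 := hexp s hs
  rw [hre, ← Real.exp_add, show -α * s ^ 2 / 4 + -α * s ^ 2 / 4 = -α * s ^ 2 / 2 by ring] at h2
  convert h2 using 2
  · congr 1
    simp only [div_eq_mul_inv, inv_pow]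
    ring
  · rw [div_eq_mul_inv, inv_pow]

/-! ### The vector frame: existence, uniqueness, orthonormality, parity. -/

lemma hasDerivAt_E3_iff {f : ℝ → E3} {f' : E3} {s : ℝ} :
    HasDerivAt f f' s ↔ ∀ j, HasDerivAt (fun t => f t j) (f' j) s := by
  constructor
  · intro h j
    exact ((PiLp.hasFDerivAt_apply (𝕜 := ℝ) 2 (f s) j).comp_hasDerivAt s h).congr_deriv (by simp)
  · intro h
    have h1 : HasDerivAt (fun t => (WithLp.ofLp (f t) : Fin 3 → ℝ)) (WithLp.ofLp f') s :=
      hasDerivAt_pi.2 h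
    exact ((PiLp.hasFDerivAt_toLp (𝕜 := ℝ) 2 (WithLp.ofLp (f s))).comp_hasDerivAt s h1).congr_deriv
      rfl

lemma isFrenetFrame_iff {c α : ℝ} {m n b : ℝ → E3} : IsFrenetFrame c α m n b ↔
    ∀ j, IsFrenetOn (curvature c α) (torsion α) Set.univ (fun s => m s j) (fun s => n s j)
      (fun s => b s j) ∧ m 0 j = (if j = 0 then 1 else 0) ∧ n 0 j = (if j = 1 then 1 else 0) ∧
      b 0 j = (if j = 2 then 1 else 0) := by
  constructor
  · intro h j
    refine ⟨⟨fun s _ => ?_, fun s _ => ?_, fun s _ => ?_⟩, ?_, ?_, ?_⟩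
    · simpa using hasDerivAt_E3_iff.1 (h.deriv_m s) j
    · simpa using hasDerivAt_E3_iff.1 (h.deriv_n s) j
    · simpa using hasDerivAt_E3_iff.1 (h.deriv_b s) j
    · simp [h.m_zero]
    · simp [h.n_zero]
    · simp [h.b_zero]
  · intro h
    refine ⟨fun s => hasDerivAt_E3_iff.2 fun j => ?_, fun s => hasDerivAt_E3_iff.2 fun j => ?_,
      fun s => hasDerivAt_E3_iff.2 fun j => ?_, ?_, ?_, ?_⟩
    · simpa using (h j).1.dx s trivial
    · simpa using (h j).1.dy s trivial
    · simpa using (h j).1.dz s trivial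
    · ext j
      simp [(h j).2.1]
    · ext j
      simp [(h j).2.2.1]
    · ext j
      simp [(h j).2.2.2]

lemma exists_isFrenetFrame (c α : ℝ) : ∃ m n b : ℝ → E3, IsFrenetFrame c α m n b := by
  have h := fun j : Fin 3 => exists_isFrenetOn_univ (continuous_curvature c α)
    (continuous_torsion α) (x₀ := if j = 0 then 1 else 0) (y₀ := if j = 1 then 1 else 0)
    (z₀ := if j = 2 then 1 else 0) (by fin_cases j <;> simp)
  choose x y z hx hy hz h using h
  exact ⟨fun s => WithLp.toLp 2 fun j => x j s, fun s => WithLp.toLp 2 fun j => y j s,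
    fun s => WithLp.toLp 2 fun j => z j s, isFrenetFrame_iff.2 fun j => ⟨h j, hx j, hy j, hz j⟩⟩

namespace IsFrenetFrame

variable {c α : ℝ} {m n b m' n' b' : ℝ → E3}

lemma unique (h : IsFrenetFrame c α m n b) (h' : IsFrenetFrame c α m' n' b') :
    m' = m ∧ n' = n ∧ b' = b := by
  rw [isFrenetFrame_iff] at h h'
  have key : ∀ s j, m' s j = m s j ∧ n' s j = n s j ∧ b' s j = b s j := fun s j =>
    (h' j).1.unique (h j).1 isOpen_univ isPreconnected_univ (t₀ := 0) trivial trivial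
      ((h' j).2.1.trans (h j).2.1.symm) ((h' j).2.2.1.trans (h j).2.2.1.symm)
      ((h' j).2.2.2.trans (h j).2.2.2.symm)
  refine ⟨?_, ?_, ?_⟩ <;> ext s j
  exacts [(key s j).1, (key s j).2.1, (key s j).2.2]

/-- The rows of the frame matrix are orthonormal. -/
lemma row_inner (h : IsFrenetFrame c α m n b) (s : ℝ) (i j : Fin 3) :
    m s i * m s j + n s i * n s j + b s i * b s j = if i = j then 1 else 0 := by
  rw [isFrenetFrame_iff] at h
  rw [(h i).1.inner_const (h j).1 isOpen_univ isPreconnected_univ (Set.mem_univ s)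
    (Set.mem_univ 0)]
  simp only [h]
  fin_cases i <;> fin_cases j <;> simp

lemma row_sq (h : IsFrenetFrame c α m n b) (s : ℝ) (j : Fin 3) :
    m s j ^ 2 + n s j ^ 2 + b s j ^ 2 = 1 := by
  simpa [sq] using h.row_inner s j j

/-- Conservation is coordinatewise and gives orthonormal rows of the frame matrix; a left inverse of
a square matrix is a right inverse, so the columns, and `m` in particular, are unit vectors. -/
lemma norm_m (h : IsFrenetFrame c α m n b) (s : ℝ) : ‖m s‖ = 1 := by
  let X : Matrix (Fin 3) (Fin 3) ℝ := Matrix.of fun i k => ![m s i, n s i, b s i] k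
  have hX : X * X.transpose = 1 := by
    ext i j
    rw [Matrix.mul_apply, Fin.sum_univ_three, Matrix.one_apply, ← h.row_inner s i j]
    simp [X]
  have hX' : X.transpose * X = 1 := mul_eq_one_comm.1 hX
  have h00 := congrFun (congrFun hX' 0) 0
  rw [Matrix.mul_apply, Matrix.one_apply_eq] at h00
  rw [EuclideanSpace.norm_eq, Real.sqrt_eq_one, ← h00]
  simp [X, sq]

/-- As `k` is even and `τ` odd, `(σ m, -σ n, -σ b)` evaluated at `-t`, with `σ = diag(1, -1, -1)`,
solves the same system with the same initial frame, so uniqueness applies. -/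
lemma neg_eq_reflect (h : IsFrenetFrame c α m n b) (s : ℝ) : m (-s) = reflect (m s) := by
  let σ : Fin 3 → ℝ := ![1, -1, -1]
  have hk : ∀ t, curvature c α (-t) = curvature c α t := fun t => by simp [curvature]
  have hτ : ∀ t, torsion α (-t) = -torsion α t := fun t => by simp [torsion, neg_div]
  have h0 := isFrenetFrame_iff.1 h
  have h' : IsFrenetFrame c α (fun t => WithLp.toLp 2 fun j => σ j * m (-t) j)
      (fun t => WithLp.toLp 2 fun j => -(σ j * n (-t) j))
      (fun t => WithLp.toLp 2 fun j => -(σ j * b (-t) j)) := by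
    refine isFrenetFrame_iff.2 fun j => ⟨⟨fun t _ => ?_, fun t _ => ?_, fun t _ => ?_⟩, ?_, ?_, ?_⟩
    · refine ((((h0 j).1.dx (-t) trivial).comp t (hasDerivAt_neg t)).const_mul (σ j)).congr_deriv ?_
      simp only [hk]
      ring
    · refine ((((h0 j).1.dy (-t) trivial).comp t
        (hasDerivAt_neg t)).const_mul (σ j)).neg.congr_deriv ?_
      simp only [hk, hτ]
      ring
    · refine ((((h0 j).1.dz (-t) trivial).comp t
        (hasDerivAt_neg t)).const_mul (σ j)).neg.congr_deriv ?_
      simp only [hτ]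
      ring
    all_goals simp only [neg_zero, h0]; fin_cases j <;> simp [σ]
  have e := congrFun (h.unique h').1 s
  rw [← e]
  ext j
  fin_cases j <;> simp [reflect, σ]

lemma continuous_m (h : IsFrenetFrame c α m n b) : Continuous m :=
  continuous_iff_continuousAt.2 fun s => (h.deriv_m s).continuousAt

end IsFrenetFrame

/-! ### The jump datum and `L^p` scaling. -/

lemma norm_le_of_abs_le {v : E3} {B : ℝ} (h : ∀ j, |v j| ≤ B) : ‖v‖ ≤ 3 * B := by
  have hB : 0 ≤ B := (abs_nonneg _).trans (h 0)
  rw [EuclideanSpace.norm_eq]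
  refine Real.sqrt_le_iff.2 ⟨by linarith, ?_⟩
  rw [Fin.sum_univ_three]
  have hj : ∀ j, ‖v j‖ ^ 2 ≤ B ^ 2 := fun j => by
    rw [Real.norm_eq_abs]
    exact pow_le_pow_left₀ (abs_nonneg _) (h j) 2
  nlinarith [hj 0, hj 1, hj 2]

lemma norm_reflect (v : E3) : ‖reflect v‖ = ‖v‖ := by
  simp [EuclideanSpace.norm_eq, reflect, Fin.sum_univ_three]

lemma reflect_sub (v w : E3) : reflect v - reflect w = reflect (v - w) := by
  ext j
  fin_cases j <;> simp [reflect] <;> ring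

lemma continuous_reflect : Continuous reflect := by
  refine (PiLp.continuous_toLp 2 _).comp (continuous_pi fun j => ?_)
  fin_cases j <;> simp <;> fun_prop

lemma jumpDatum_of_pos (A : E3) {x : ℝ} (hx : 0 < x) : jumpDatum A x = A := by
  simp [jumpDatum, hx, hx.le]

lemma jumpDatum_of_neg (A : E3) {x : ℝ} (hx : x < 0) : jumpDatum A x = reflect A := by
  simp [jumpDatum, hx, hx.le]

lemma jumpDatum_zero (A : E3) : jumpDatum A 0 = 0 := by simp [jumpDatum]

lemma jumpDatum_mul (A : E3) {r : ℝ} (hr : 0 < r) (x : ℝ) :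
    jumpDatum A (x * r) = jumpDatum A x := by
  rcases lt_trichotomy x 0 with hx | rfl | hx
  · rw [jumpDatum_of_neg A hx, jumpDatum_of_neg A (mul_neg_of_neg_of_pos hx hr)]
  · rw [zero_mul]
  · rw [jumpDatum_of_pos A hx, jumpDatum_of_pos A (mul_pos hx hr)]

lemma measurable_jumpDatum (A : E3) : Measurable (jumpDatum A) :=
  (measurable_const.indicator measurableSet_Ioi).add (measurable_const.indicator measurableSet_Iio)

/-- Dilations act on the `L^p` seminorm by a power of the scale. -/
lemma eLpNorm_comp_mul_right {f : ℝ → E3} (hf : Measurable f) {p : ENNReal} (hp : p ≠ ⊤) {r : ℝ}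
    (hr : 0 < r) : eLpNorm (fun x => f (x * r)) p volume =
      ENNReal.ofReal r⁻¹ ^ (1 / p).toReal * eLpNorm f p volume := by
  have h := eLpNorm_map_measure (μ := volume) (p := p) (f := fun x : ℝ => x * r) (g := f)
    hf.aestronglyMeasurable (by fun_prop)
  rw [Real.map_volume_mul_right hr.ne', eLpNorm_smul_measure_of_ne_top hp,
    abs_of_pos (inv_pos.2 hr), smul_eq_mul] at h
  exact h.symm

/-- The hypothesis `1 < p` is exactly what makes `(1 + |x|)^{-p}` integrable on the line. -/
lemma memLp_of_norm_le_inv {f : ℝ → E3} (hf : Measurable f) {B p : ℝ} (hp : 1 < p)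
    (h : ∀ x, ‖f x‖ ≤ B * (1 + |x|)⁻¹) : MemLp f (ENNReal.ofReal p) volume := by
  have hp0 : 0 < p := by linarith
  have hg : MemLp (fun x : ℝ => (1 + |x|)⁻¹) (ENNReal.ofReal p) volume := by
    rw [← integrable_norm_rpow_iff (Measurable.aestronglyMeasurable (by fun_prop))
      (by simpa using hp0) ENNReal.ofReal_ne_top, ENNReal.toReal_ofReal hp0.le]
    refine (integrable_one_add_norm (E := ℝ) (μ := volume) (r := p) (by simpa using hp)).congr
      (Eventually.of_forall fun x => ?_)
    have : 0 ≤ 1 + |x| := by positivity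
    simp only [Real.norm_eq_abs, abs_inv, abs_of_nonneg this]
    rw [Real.rpow_neg this, Real.inv_rpow this]
  refine (hg.const_mul B).mono hf.aestronglyMeasurable (Eventually.of_forall fun x => ?_)
  exact (h x).trans (le_abs_self _)

end Expander

/-! ### The theorem. -/

open Expander in
theorem theorem5p4 (c : ℝ) (hc : 0 ≤ c) :
    -- the error constant depends on `c` only
    ∃ K : ℝ, 0 < K ∧ ∀ α : ℝ, α ∈ Set.Icc (0 : ℝ) 1 →
      -- the profile `m` comes from the unique global solution of the Serret-Frenet system
      ∃ m n b : ℝ → Expander.E3, Expander.IsFrenetFrame c α m n b ∧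
        (∀ m' n' b' : ℝ → Expander.E3, Expander.IsFrenetFrame c α m' n' b' →
          m' = m ∧ n' = n ∧ b' = b) ∧
        -- parity of the components
        (∀ s, m (-s) 0 = m s 0) ∧ (∀ s, m (-s) 1 = -m s 1) ∧ (∀ s, m (-s) 2 = -m s 2) ∧
        ∃ A : Expander.E3, ‖A‖ = 1 ∧
          -- asymptotic expansion
          (∃ a : Fin 3 → ℝ, (∀ j, a j ∈ Set.Ico (0 : ℝ) (2 * Real.pi)) ∧
            ∀ s : ℝ, Expander.s0 c ≤ s → ∀ j : Fin 3,
              |m s j - Expander.expansion c α A a s j| ≤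
                K * (Real.exp (-α * s ^ 2 / 4) / s ^ 3)) ∧
          -- pointwise convergence to the jump datum
          (∀ x : ℝ, 0 < x →
            Tendsto (fun t : ℝ => m (x / Real.sqrt t)) (𝓝[>] 0) (𝓝 A)) ∧
          (∀ x : ℝ, x < 0 →
            Tendsto (fun t : ℝ => m (x / Real.sqrt t)) (𝓝[>] 0) (𝓝 (Expander.reflect A))) ∧
          -- rate of convergence in `L^p`
          (∀ p : ℝ, 1 < p → ∃ C : ℝ, 0 < C ∧ ∀ t : ℝ, 0 < t →
            eLpNorm (fun x : ℝ => m (x / Real.sqrt t) - Expander.jumpDatum A x)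
              (ENNReal.ofReal p) volume ≤ ENNReal.ofReal (C * t ^ (1 / (2 * p)))) := by
  -- The `+ 1` secures strict positivity, as `errorRate 0 = 0`.
  refine ⟨errorRate c + 1, by linarith [errorRate_nonneg hc], fun α hα => ?_⟩
  obtain ⟨m, n, b, h⟩ := exists_isFrenetFrame c α
  have hneg := h.neg_eq_reflect
  refine ⟨m, n, b, h, fun m' n' b' h' => h.unique h', fun s => by rw [hneg]; simp [reflect],
    fun s => by rw [hneg]; simp [reflect], fun s => by rw [hneg]; simp [reflect], ?_⟩
  have hj := fun j => (isFrenetFrame_iff.1 h j).1.exists_expansion hc hα fun s => h.row_sq s j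
  choose A a ha hA hrate hexp using hj
  have hmA : Tendsto m atTop (𝓝 (WithLp.toLp 2 A)) :=
    ((PiLp.continuous_toLp 2 _).tendsto A).comp (tendsto_pi_nhds.2 hA)
  have hA1 : ‖(WithLp.toLp 2 A : E3)‖ = 1 :=
    tendsto_nhds_unique hmA.norm (by simpa only [h.norm_m] using tendsto_const_nhds)
  have hdiv : ∀ x : ℝ, 0 < x → Tendsto (fun t : ℝ => x / Real.sqrt t) (𝓝[>] 0) atTop := by
    intro x hx
    have h0 : Tendsto Real.sqrt (𝓝[>] 0) (𝓝[>] 0) := by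
      refine tendsto_nhdsWithin_iff.2 ⟨?_, ?_⟩
      · simpa using (Real.continuous_sqrt.tendsto 0).mono_left nhdsWithin_le_nhds
      · filter_upwards [self_mem_nhdsWithin] with t ht using Real.sqrt_pos.2 ht
    simpa [div_eq_mul_inv] using (tendsto_inv_nhdsGT_zero.comp h0).const_mul_atTop hx
  refine ⟨WithLp.toLp 2 A, hA1, ⟨a, ha, fun s hs j => ?_⟩, fun x hx => hmA.comp (hdiv x hx),
    fun x hx => ?_, fun p hp => ?_⟩
  · have hs1 : 1 ≤ s := (one_le_s0 c).trans hs
    refine (hexp j s hs1).trans ?_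
    have : 0 ≤ Real.exp (-α * s ^ 2 / 4) / s ^ 3 := by positivity
    linarith
  · have h1 := (continuous_reflect.tendsto _).comp (hmA.comp (hdiv (-x) (neg_pos.2 hx)))
    refine h1.congr fun t => ?_
    simp only [Function.comp_apply]
    rw [← hneg, neg_div, neg_neg]
  · set A' : E3 := WithLp.toLp 2 A
    have hp0 : 0 < p := by linarith
    have hmeas : Measurable fun x => m x - jumpDatum A' x :=
      h.continuous_m.measurable.sub (measurable_jumpDatum A')
    have hr0 := tangentRate_nonneg hc
    have hpos : ∀ x, 1 ≤ x → ‖m x - A'‖ ≤ 3 * (tangentRate c * x⁻¹) := fun x hx =>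
      norm_le_of_abs_le fun j => by
        have hx0 : 0 ≤ x⁻¹ := by positivity
        refine (hrate j x hx).trans ?_
        gcongr
        exact mul_le_of_le_one_left hx0 (gaussian_le_one hα.1 x)
    have hbig : ∀ x, 1 ≤ |x| → ‖m x - jumpDatum A' x‖ ≤ 3 * (tangentRate c * |x|⁻¹) := by
      intro x hx
      rcases le_total 0 x with h0 | h0
      · rw [abs_of_nonneg h0] at hx ⊢
        rw [jumpDatum_of_pos A' (by linarith)]
        exact hpos x hx
      · rw [abs_of_nonpos h0] at hx ⊢
        have e : m x = reflect (m (-x)) := by rw [← hneg, neg_neg]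
        rw [jumpDatum_of_neg A' (by linarith), e, reflect_sub, norm_reflect]
        exact hpos (-x) hx
    have hsmall : ∀ x, ‖m x - jumpDatum A' x‖ ≤ 2 := by
      intro x
      refine (norm_sub_le _ _).trans ?_
      rw [h.norm_m]
      have : ‖jumpDatum A' x‖ ≤ 1 := by
        rcases lt_trichotomy x 0 with hx | rfl | hx
        · rw [jumpDatum_of_neg A' hx, norm_reflect, hA1]
        · rw [jumpDatum_zero, norm_zero]; exact zero_le_one
        · rw [jumpDatum_of_pos A' hx, hA1]
      linarith
    have hmem : MemLp (fun x => m x - jumpDatum A' x) (ENNReal.ofReal p) volume := by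
      refine memLp_of_norm_le_inv hmeas (B := 4 + 6 * tangentRate c) hp fun x => ?_
      rcases le_total 1 |x| with hx | hx
      · refine (hbig x hx).trans ?_
        have hx0 : 0 < |x| := by linarith
        rw [← div_eq_mul_inv, ← div_eq_mul_inv, ← mul_div_assoc,
          div_le_div_iff₀ hx0 (by linarith)]
        nlinarith [mul_le_mul_of_nonneg_left hx hr0]
      · refine (hsmall x).trans ?_
        have hx0 := abs_nonneg x
        rw [← div_eq_mul_inv, le_div_iff₀ (by linarith)]
        linarith
    -- The constant is the norm at `t = 1`, plus `1` for positivity; by invariance of the jump datum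
    -- every other time is a dilation by `√t`, contributing `(√t)^{1/p}`.
    refine ⟨(eLpNorm (fun x => m x - jumpDatum A' x) (ENNReal.ofReal p) volume).toReal + 1,
      by positivity, fun t ht => ?_⟩
    have hst : 0 < Real.sqrt t := Real.sqrt_pos.2 ht
    have e : (fun x : ℝ => m (x / Real.sqrt t) - jumpDatum A' x) =
        fun x => (fun y => m y - jumpDatum A' y) (x * (Real.sqrt t)⁻¹) := by
      funext x
      simp only [jumpDatum_mul A' (inv_pos.2 hst), div_eq_mul_inv]
    have e2 : ENNReal.ofReal (Real.sqrt t) ^ (1 / ENNReal.ofReal p).toReal =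
        ENNReal.ofReal (t ^ (1 / (2 * p))) := by
      rw [one_div, ENNReal.toReal_inv, ENNReal.toReal_ofReal hp0.le,
        ENNReal.ofReal_rpow_of_pos hst, Real.sqrt_eq_rpow, ← Real.rpow_mul ht.le]
      congr 2
      field_simp
    rw [e, eLpNorm_comp_mul_right hmeas ENNReal.ofReal_ne_top (inv_pos.2 hst), inv_inv, e2,
      ← ENNReal.ofReal_toReal hmem.eLpNorm_ne_top, ← ENNReal.ofReal_mul (by positivity)]
    refine ENNReal.ofReal_le_ofReal ?_
    rw [mul_comm]
    gcongr
    rw [ENNReal.toReal_ofReal ENNReal.toReal_nonneg]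
    linarith
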